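/- **Parameters.** Let $\lambda_B,\lambda_D>0$ (densities of base stations (BSs) and devices), $\alpha>2$ (path-loss exponent), $P_{DL},\omega>0$ (downlink power and noise), $\delta_1>\delta_2>0$ (SNR thresholds), $\rho,P,\sigma^2,\gamma_{th}>0$ (power-control threshold, maximal/fixed uplink power, uplink noise, SINR threshold), $S_i\ge 1$ and $K_i$ ($i=0,1,2$) the numbers of preambles and of repetitions of coverage enhancement (CE) group $i$, $\mu_{New}^t=(\tau_r+\tau_g)\varepsilon^t_{New}>0$ with $\tau_r,\tau_g,\varepsilon^t_{New}>0$ (mean number of new packets in slot $t\ge 1$), $Q_{ACB}\in[0,1]$, $T_{BO}\in\mathbb N$, $c=3.575$. Put $D_0=(\delta_1\omega/P_{DL})^{-1/\alpha}$, $D_1=(\delta_2\omega/P_{DL})^{-1/\alpha}$, $D_2=1/\sqrt{\pi\lambda_B}$, $g_0=1-e^{-\lambda_B\pi D_0^2}$, $g_1=e^{-\lambda_B\pi D_0^2}-e^{-\lambda_B\pi D_1^2}$, and $g_2=e^{-\lambda_B\pi D_1^2}-e^{-\lambda_B\pi D_2^2}$ in Case 1 (group 2 has outer radius $D_2$; then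 $D_1<D_2$ is assumed for group 2), $g_2=e^{-\lambda_B\pi D_1^2}$ in Case 2 (group 2 extends to the boundary of the Voronoi cell). Let $\lambda_i^a=g_i\lambda_D/S_i$. **Model of slot $t$ for group $i$.** Let $\mathcal A_i^t$, $\mathcal R_i^t$, $\mathcal P_i^t$ be the non-empty, non-restrict and RACH success probabilities. (a) *Queue.* $\mathcal A_i^t=\mathbb P\{N_{New}^t+N_{Cum,i}^t>0\}$, where $N_{New}^t\sim\mathrm{Pois}(\mu_{New}^t)$ and $N_{Cum,i}^t\sim\mathrm{Pois}(\mu_{Cum,i}^t)$ are independent, $\mu^1_{Cum,i}=0$ and, for $t>1$, $\mu_{Cum,i}^t$ is $\mu_{New}^{t-1}+\mu_{Cum,i}^{t-1}$ minus the mean number of departures in slot $t-1$; that number is $g_i\mathcal P_i^{t-1}\mathcal R_i^{t-1}\mathcal A_i^{t-1}$ for the Baseline, ACB and BO schemes, and $g_iQ_{ACB}\mathcal P_i^{t-1}\mathcal R_i^{t-1}\mathcal A_i^{t-1}$ for ACB&BO. (b) *Restriction.* Baseline: no restriction. ACB: a device attempts RACH if $q<Q_{ACB}$, with $q$ uniform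 on $[0,1]$. BO and ACB&BO: $1-\mathcal R_i^t$ is the total probability of a failed attempt in the last $T_{BO}$ slots divided by $\mathcal A_i^t$, the probability of a failed attempt in slot $s$ being $(1-g_i\mathcal P_i^{s})\mathcal A_i^{s}\mathcal R_i^{s}$, respectively $(1-g_iQ_{ACB}\mathcal P_i^{s})\mathcal A_i^{s}\mathcal R_i^{s}$. (c) *Intra-group interferers.* The area of the cell of the typical device has the gamma law of shape $c+1$ and rate $c\lambda_B$; given that it equals $a$, the number $N_i$ of active devices of the same group in that cell using the same preamble is Poisson with mean $\mathcal A_i^t\mathcal R_i^t\lambda_i^a\,a$. (d) *Preamble transmission.* A preamble is sent $K_i$ times, each time in four symbol groups; it is received if in some repetition all four SINRs at the BS are at least $\gamma_{th}$. A device at distance $r$ from its BS transmits with power $\rho r^\alpha$ if $i=0$, and $P$ if $i=1,2$; a signal of power $p$ sent from distance $x$ is received with power $p\,h\,x^{-\alpha}$, with i.i.d. gains $h\sim\mathrm{Exp}(1)$ over devices, repetitions and symbol groups; the noise is $\sigma^2$. The position of the device is arbitrary (a.s. not at the BS) if $i=0$, uniform in the annulus $D_{i-1}<r\le D_i$ if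 $i=1$, or $i=2$ in Case 1, and distributed as the displacement from a device to its nearest BS given that its length exceeds $D_1$ if $i=2$ in Case 2 (the displacement having density $\lambda_Be^{-\pi\lambda_B\|x\|^2}$ on $\mathbb R^2$). The active devices using the same preamble form an independent homogeneous Poisson process of density $\mathcal A_i^t\mathcal R_i^t\lambda_i^a$ (the same in all repetitions), with i.i.d. transmit powers. For $i=1,2$ the power is $P$, and the interferers are the points at distance more than $D_i$ from the BS ($D_1$ for $i=2$ in Case 2). For $i=0$ the power is $\rho\ell^\alpha$, with $\ell$ the length of a displacement as above conditioned on $\ell\le(P/\rho)^{1/\alpha}$, and a point is an interferer if its distance from the BS is more than its own $\ell$. (e) *Success.* With $\mathbb P_{S,i,m}[K_i]$ the probability that the preamble of device $m$ is received ($m=0$: the typical device; $m\ge1$: the intra-group interferers, with the same law), $$\mathcal P_i^t=\mathbb E_{N_i}\Big[\mathbb P_{S,i,0}[K_i]\prod_{m=1}^{N_i}\big(1-\mathbb P_{S,i,m}[K_i]\big)\Big].$$ **Theorem 3.** For each group $i\in\{0,1,2\}$ (and, for $i=2$, in both cases), each of the Baseline, ACB, BO and ACB&BO schemes, and every $t\ge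 1$, $$\mathcal P_i^t=\sum_{n=0}^\infty O[n,t]\,\Theta[K_i,t]\,(1-\Theta[K_i,t])^{n},$$ the series being convergent, where: 1. $$O[n,t]=\mathbb P[N_i=n]=\frac{c^{c+1}\,\Gamma(n+c+1)\,\big(\mathcal A_i^t\mathcal R_i^t\lambda_i^a/\lambda_B\big)^n}{\Gamma(c+1)\,\Gamma(n+1)\,\big(\mathcal A_i^t\mathcal R_i^t\lambda_i^a/\lambda_B+c\big)^{n+c+1}}.$$ 2. $\Theta[K_i,t]$ is the preamble transmission success probability $\mathbb P_{S,i,m}[K_i]$ of every device $m\ge0$, and, with $l=4k$, $\Theta[K_i,t]=\sum_{k=1}^{K_i}(-1)^{k+1}\binom{K_i}{k}\,p_i(l)$, where $$p_0(l)=\exp\Big(-\frac{l\gamma_{th}\sigma^2}{\rho}-\frac{2\gamma_{th}^{2/\alpha}\mathcal A_0^t\mathcal R_0^t\lambda_0^a\,\gamma\big(2,\pi\lambda_B(P/\rho)^{2/\alpha}\big)}{\lambda_B\big(1-e^{-\pi\lambda_B(P/\rho)^{2/\alpha}}\big)}\mathcal F_0\Big),\qquad \mathcal F_0=\int_{\gamma_{th}^{-1/\alpha}}^\infty\Big[1-\Big(\frac1{1+y^{-\alpha}}\Big)^{l}\Big]y\,dy,$$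 with $\gamma(a,b)=\int_0^b s^{a-1}e^{-s}ds$, and for $i=1,2$ $$p_i(l)=\int_{D_{i-1}}^{D_i}\exp\Big(-\frac{l\gamma_{th}\sigma^2r^\alpha}{P}\Big)\exp\big(-2\pi\mathcal A_i^t\mathcal R_i^t\lambda_i^a\mathcal F_i\big)f_R(r)\,dr,\qquad \mathcal F_i=\int_{D_i}^\infty\Big(1-\Big(\frac1{1+\gamma_{th}r^\alpha y^{-\alpha}}\Big)^{l}\Big)y\,dy,$$ with $f_R(r)=2r/(D_i^2-D_{i-1}^2)$; for $i=2$ in Case 2 the integral over $r$ runs over $(D_1,\infty)$, the lower limit in $\mathcal F_2$ is $D_1$, and $f_R(r)=2\pi\lambda_Br\,e^{-\lambda_B\pi(r^2-D_1^2)}$. 3. $\mathcal A_i^t$ and $\mathcal R_i^t$ are given by the iteration $\mathcal A_i^t=1-e^{-\mu_{New}^t-\mu_{Cum,i}^t}$, $\mu_{Cum,i}^1=0$, and, for $t>1$, $\mu_{Cum,i}^t=\mu_{New}^{t-1}+\mu_{Cum,i}^{t-1}-\kappa\,\mathcal P_i^{t-1}\mathcal A_i^{t-1}$, where $\kappa=g_i$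 (Baseline), $g_iQ_{ACB}$ (ACB), $g_i\mathcal R_i^{t-1}$ (BO), $g_iQ_{ACB}\mathcal R_i^{t-1}$ (ACB&BO); and $\mathcal R^t=1$ (Baseline), $\mathcal R^t=Q_{ACB}$ (ACB), $$\mathcal R_i^t=1-\frac{1}{\mathcal A_i^t}\sum_{s=1}^{t-1}(1-e_i\mathcal P_i^{t-s})\mathcal A_i^{t-s}\mathcal R_i^{t-s}\ \ (t\le T_{BO}+1),\qquad \mathcal R_i^t=1-\frac{1}{\mathcal A_i^t}\sum_{s=1}^{T_{BO}}(1-e_i\mathcal P_i^{t-s})\mathcal A_i^{t-s}\mathcal R_i^{t-s}\ \ (t>T_{BO}),$$ with $e_i=g_i$ for BO and $e_i=g_iQ_{ACB}$ for ACB&BO. -/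

import Mathlib

open MeasureTheory ProbabilityTheory
open scoped NNReal ENNReal

noncomputable section

namespace NBIoT

/-! ### Poisson point processes -/

/-- `Φ` is a Poisson point process on `E` with intensity measure `Λ`, seen as a random measure:
`Φ ω B` is the number of points of the configuration `ω` in the set `B`. -/
structure IsPoissonProcess {Ω E : Type*} [MeasurableSpace Ω] [MeasurableSpace E]
    (Pr : Measure Ω) (Φ : Ω → Measure E) (Λ : Measure E) : Prop where
  measurable : Measurable Φ
  count_law : ∀ B : Set E, MeasurableSet B → Λ B ≠ ∞ →
    Pr.map (fun ω => Φ ω B) =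
      (poissonMeasure (Λ B).toNNReal).map (fun n : ℕ => (n : ℝ≥0∞))
  indep : ∀ (n : ℕ) (B : Fin n → Set E), (∀ k, MeasurableSet (B k)) →
    Pairwise (fun k l => Disjoint (B k) (B l)) → iIndepFun (fun k ω => Φ ω (B k)) Pr

/-! ### Network parameters -/

/-- The two conventions for the outer radius of coverage enhancement (CE) group 2. -/
inductive OuterCase
  /-- the outer radius is `D₂ = 1 / √(π λ_B)` -/
  | fixedRadius
  /-- the outer boundary is that of the Voronoi cell -/
  | voronoiCell

/-- The four random access schemes. -/
inductive Scheme
  | baseline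
  | acb
  | bo
  | acbbo

/-- The parameters of the network. -/
structure Network where
  /-- density of base stations (BSs) -/
  lamB : ℝ
  /-- density of devices -/
  lamD : ℝ
  /-- path-loss exponent -/
  α : ℝ
  /-- downlink transmit power -/
  PDL : ℝ
  /-- upper downlink SNR threshold -/
  δ₁ : ℝ
  /-- lower downlink SNR threshold -/
  δ₂ : ℝ
  /-- downlink noise power -/
  noiseDL : ℝ
  /-- power control threshold of CE group 0 -/
  ρ : ℝ
  /-- fixed uplink transmit power of CE groups 1 and 2, and maximal power in CE group 0 -/
  P : ℝ
  /-- uplink noise power `σ²` -/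
  noise : ℝ
  /-- SINR threshold -/
  γth : ℝ
  /-- number of preambles of each group -/
  S : Fin 3 → ℕ
  /-- repetition value of each group -/
  K : Fin 3 → ℕ
  /-- duration of the random access interval -/
  τr : ℝ
  /-- duration of the gap interval -/
  τg : ℝ
  /-- intensity of the packet arrivals in each time slot -/
  ε : ℕ → ℝ
  /-- ACB factor -/
  Q : ℝ
  /-- back-off factor -/
  T : ℕ
  /-- convention for the outer radius of CE group 2 -/
  outer : OuterCase
  lamB_pos : 0 < lamB
  lamD_pos : 0 < lamD
  two_lt_α : 2 < α
  PDL_pos : 0 < PDL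
  δ₂_pos : 0 < δ₂
  δ₂_lt_δ₁ : δ₂ < δ₁
  noiseDL_pos : 0 < noiseDL
  ρ_pos : 0 < ρ
  P_pos : 0 < P
  noise_pos : 0 < noise
  γth_pos : 0 < γth
  S_pos : ∀ i, 0 < S i
  τr_pos : 0 < τr
  τg_pos : 0 < τg
  ε_pos : ∀ t, 0 < ε t
  Q_mem : Q ∈ Set.Icc (0 : ℝ) 1

namespace Network

variable (net : Network)

/-- outer radius of the coverage area of CE group 0 -/
def D₀ : ℝ := (net.δ₁ * net.noiseDL / net.PDL) ^ (-(1 / net.α))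

/-- outer radius of the coverage area of CE group 1 -/
def D₁ : ℝ := (net.δ₂ * net.noiseDL / net.PDL) ^ (-(1 / net.α))

/-- outer radius of the coverage area of CE group 2, in the fixed-radius case -/
def D₂ : ℝ := 1 / Real.sqrt (Real.pi * net.lamB)

/-- thinning probability `g_i` -/
def g : Fin 3 → ℝ
  | 0 => 1 - Real.exp (-(net.lamB * Real.pi * net.D₀ ^ 2))
  | 1 => Real.exp (-(net.lamB * Real.pi * net.D₀ ^ 2))
      - Real.exp (-(net.lamB * Real.pi * net.D₁ ^ 2))
  | 2 => match net.outer with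
    | .fixedRadius => Real.exp (-(net.lamB * Real.pi * net.D₁ ^ 2))
        - Real.exp (-(net.lamB * Real.pi * net.D₂ ^ 2))
    | .voronoiCell => Real.exp (-(net.lamB * Real.pi * net.D₁ ^ 2))

/-- density of the devices of CE group `i` that choose a given preamble -/
def lamA (i : Fin 3) : ℝ := net.g i * net.lamD / (net.S i : ℝ)

/-- mean number of packets arriving at a device in time slot `t` -/
def μNew (t : ℕ) : ℝ := (net.τr + net.τg) * net.ε t

end Network

/-! ### The spatial model of one preamble transmission -/

/-- The plane, with the receiving BS at the origin. -/
abbrev Plane := EuclideanSpace ℝ (Fin 2)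

/-- Channel power gains of one link: one for each repetition and each of its four symbol groups. -/
abbrev Gains (K : ℕ) := Fin K × Fin 4 → ℝ

/-- An interferer: location, transmit power, channel power gains to the BS at the origin. -/
abbrev Interferer (K : ℕ) := Plane × ℝ × Gains K

/-- Rayleigh fading: independent `Exp(1)` channel power gains. -/
def gainLaw (K : ℕ) : Measure (Gains K) := Measure.pi (fun _ => expMeasure 1)

/-- Law of the displacement from a device to the nearest point of a homogeneous Poisson process of
BSs of density `lamB`. -/
def contactLaw (lamB : ℝ) : Measure Plane :=
  volume.withDensity
    (fun x => ENNReal.ofReal (lamB * Real.exp (-(Real.pi * lamB * ‖x‖ ^ 2))))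

/-- `ν` is an admissible law of the position, relative to its BS, of a randomly chosen device of
CE group `i`. In group 0 (where power control makes the position irrelevant) every law without an
atom at the BS is allowed; in group 1, and in group 2 with fixed outer radius, the position is
uniform in the annulus; in group 2 with Voronoi outer boundary, it is the displacement between a
device and its nearest BS, given that it is longer than `D₁`. -/
def IsPositionLaw (net : Network) (i : Fin 3) (ν : Measure Plane) : Prop :=
  match i with
  | 0 => ν {0} = 0
  | 1 => ν = cond volume {x : Plane | net.D₀ < ‖x‖ ∧ ‖x‖ ≤ net.D₁}
  | 2 => match net.outer with
    | .fixedRadius => ν = cond volume {x : Plane | net.D₁ < ‖x‖ ∧ ‖x‖ ≤ net.D₂}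
    | .voronoiCell => ν = cond (contactLaw net.lamB) {x : Plane | net.D₁ < ‖x‖}

/-- Uplink transmit power of a device of CE group `i` at distance `r` from its BS: path-loss
inversion in group 0, fixed power in groups 1 and 2. -/
def txPower (net : Network) (i : Fin 3) (r : ℝ) : ℝ :=
  match i with
  | 0 => net.ρ * r ^ net.α
  | 1 => net.P
  | 2 => net.P

/-- Law of the transmit power of an interferer. In group 0 the interferer inverts the path loss of
the link to its own nearest BS, given that the power needed is at most the maximal one. -/
def powerLaw (net : Network) (i : Fin 3) : Measure ℝ :=
  match i with
  | 0 => (cond (contactLaw net.lamB)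
      {x : Plane | ‖x‖ ≤ (net.P / net.ρ) ^ (1 / net.α)}).map (fun x => txPower net 0 ‖x‖)
  | 1 => Measure.dirac net.P
  | 2 => Measure.dirac net.P

/-- Distance from the typical BS beyond which a point of the process of devices of group `i`,
transmitting with power `p`, is an interferer. In group 0 this is the distance of that device to
its own BS, `(p / ρ) ^ (1 / α)`: a device served by another BS is farther from the typical one. -/
def exclusionRadius (net : Network) (i : Fin 3) (p : ℝ) : ℝ :=
  match i with
  | 0 => (p / net.ρ) ^ (1 / net.α)
  | 1 => net.D₁
  | 2 => match net.outer with
    | .fixedRadius => net.D₂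
    | .voronoiCell => net.D₁

/-- The random elements of the preamble transmission of one device. -/
structure Transmission (Ω : Type*) (K : ℕ) where
  /-- position relative to the BS -/
  position : Ω → Plane
  /-- channel power gains of the link to the BS -/
  gain : Ω → Gains K
  /-- process of the active devices using the same preamble, each with its power and gains -/
  field : Ω → Measure (Interferer K)

section Transmission

variable {Ω : Type*} [MeasurableSpace Ω]

/-- The law of a transmission in group `i` when the active devices using the same preamble have
density `x`: a homogeneous Poisson process of density `x`, with independent marks (power, gains). -/
structure Transmission.HasModelLaw (net : Network) (i : Fin 3) (x : ℝ) (Pr : Measure Ω)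
    (X : Transmission Ω (net.K i)) : Prop where
  measurable_position : Measurable X.position
  measurable_gain : Measurable X.gain
  position_law : IsPositionLaw net i (Pr.map X.position)
  gain_law : Pr.map X.gain = gainLaw (net.K i)
  field_law : IsPoissonProcess Pr X.field
    ((ENNReal.ofReal x • (volume : Measure Plane)).prod
      ((powerLaw net i).prod (gainLaw (net.K i))))
  indep_gain : IndepFun X.gain (fun ω => (X.position ω, X.field ω)) Pr
  indep_position : IndepFun X.position X.field Pr

/-- Aggregate interference in the `b`-th symbol group of the `k`-th repetition. -/
def Transmission.interference (net : Network) (i : Fin 3) (X : Transmission Ω (net.K i))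
    (k : Fin (net.K i)) (b : Fin 4) (ω : Ω) : ℝ≥0∞ :=
  ∫⁻ z in {z : Interferer (net.K i) | exclusionRadius net i z.2.1 < ‖z.1‖},
    ENNReal.ofReal (z.2.1 * z.2.2 (k, b) * ‖z.1‖ ^ (-net.α)) ∂(X.field ω)

/-- Received SINR in the `b`-th symbol group of the `k`-th repetition. -/
def Transmission.sinr (net : Network) (i : Fin 3) (X : Transmission Ω (net.K i))
    (k : Fin (net.K i)) (b : Fin 4) (ω : Ω) : ℝ≥0∞ :=
  ENNReal.ofReal (txPower net i ‖X.position ω‖ * X.gain ω (k, b) * ‖X.position ω‖ ^ (-net.α))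
    / (X.interference net i k b ω + ENNReal.ofReal net.noise)

/-- The preamble is received: in some repetition, the SINRs of all four symbol groups reach the
threshold. -/
def Transmission.received (net : Network) (i : Fin 3) (X : Transmission Ω (net.K i)) : Set Ω :=
  {ω | ∃ k : Fin (net.K i), ∀ b : Fin 4, ENNReal.ofReal net.γth ≤ X.sinr net i k b ω}

end Transmission

/-! ### The model over several time slots -/

/-- The constant of the gamma approximation of the area of a Poisson-Voronoi cell. -/
def cellConst : ℝ := 3.575

/-- The random elements of the model; time slots are numbered `1, 2, …`. -/
structure History (Ω : Type*) (K : ℕ) where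
  /-- number of packets arriving at a device in slot `t` -/
  newPackets : ℕ → Ω → ℕ
  /-- number of packets accumulated at a device before slot `t` -/
  cumPackets : ℕ → Ω → ℕ
  /-- number of active devices of the group, in the cell of the typical device, using its preamble -/
  intra : ℕ → Ω → ℕ
  /-- `device t 0` is the transmission of the typical device in slot `t`, and `device t m`,
  `m ≥ 1`, that of the `m`-th intra-group interfering device -/
  device : ℕ → ℕ → Transmission Ω K

/-- Probability that a RACH attempt admitted by the back-off rule is carried out. -/
def passProb (net : Network) : Scheme → ℝ
  | .baseline => 1
  | .acb => 1
  | .bo => 1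
  | .acbbo => net.Q

/-- Non-restrict probability under back-off, for given sequences `A` of non-empty probabilities and
`P` of success probabilities. An attempt made in slot `s` fails with probability
`(1 - e * P s) * A s * R s`, and the device then defers in the next `T` slots. -/
def backoffProb (e : ℝ) (T : ℕ) (A P : ℕ → ℝ) : ℕ → ℝ
  | t => 1 - (∑ s : Fin (min (t - 1) T),
      (1 - e * P (t - (s.val + 1))) * A (t - (s.val + 1))
        * backoffProb e T A P (t - (s.val + 1))) / A t
  termination_by t => t
  decreasing_by
    have := s.isLt
    omega

section History

variable {Ω : Type*} [MeasurableSpace Ω]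

/-- Non-empty probability `𝒜ᵗ`. -/
def History.nonEmpty {K : ℕ} (H : History Ω K) (Pr : Measure Ω) (t : ℕ) : ℝ :=
  Pr.real {ω | 0 < H.newPackets t ω + H.cumPackets t ω}

variable (net : Network) (i : Fin 3)

/-- Preamble transmission success probability of the `m`-th device. -/
def History.preamble (H : History Ω (net.K i)) (Pr : Measure Ω) (t m : ℕ) : ℝ :=
  Pr.real ((H.device t m).received net i)

/-- RACH success probability `𝒫ᵗ`: the expectation, over the number of intra-group interfering
devices, of the probability that the preamble of the typical device is received and those of all
the others are not. -/
def History.success (H : History Ω (net.K i)) (Pr : Measure Ω) (t : ℕ) : ℝ :=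
  ∫ ω, H.preamble net i Pr t 0 *
    ∏ m ∈ Finset.Icc 1 (H.intra t ω), (1 - H.preamble net i Pr t m) ∂Pr

/-- Non-restrict probability `ℛᵗ`. Under ACB a device draws `q` uniformly from `[0,1]` and attempts
RACH when `q < Q`. -/
def History.nonRestrict (sch : Scheme) (H : History Ω (net.K i)) (Pr : Measure Ω) (t : ℕ) : ℝ :=
  match sch with
  | .baseline => 1
  | .acb => (volume.restrict (Set.Icc (0 : ℝ) 1)).real {q | q < net.Q}
  | .bo => backoffProb (net.g i * passProb net .bo) net.T
      (H.nonEmpty Pr) (H.success net i Pr) t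
  | .acbbo => backoffProb (net.g i * passProb net .acbbo) net.T
      (H.nonEmpty Pr) (H.success net i Pr) t

/-- Mean number `μ_Cum` of accumulated packets: what was in the buffer in the previous slot, minus
the mean number of departures in that slot. -/
def History.μCum (sch : Scheme) (H : History Ω (net.K i)) (Pr : Measure Ω) : ℕ → ℝ
  | 0 => 0
  | 1 => 0
  | t + 2 => net.μNew (t + 1) + History.μCum sch H Pr (t + 1)
      - net.g i * passProb net sch * H.success net i Pr (t + 1)
        * H.nonRestrict net i sch Pr (t + 1) * H.nonEmpty Pr (t + 1)

/-- Density of the active devices of the group that use a given preamble in slot `t`. -/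
def History.activeDensity (sch : Scheme) (H : History Ω (net.K i)) (Pr : Measure Ω)
    (t : ℕ) : ℝ :=
  H.nonEmpty Pr t * H.nonRestrict net i sch Pr t * net.lamA i

/-- The laws of the random elements of the model. New packets are Poisson; accumulated packets are
approximated by a Poisson variable with the mean above. The number of intra-group interferers is
Poisson, given the area of the cell containing the typical device, and that area has the usual
size-biased gamma law (shape `c + 1`, rate `c λ_B`). -/
structure History.IsModel (sch : Scheme) (H : History Ω (net.K i)) (Pr : Measure Ω) :
    Prop where
  measurable_new : ∀ t, 1 ≤ t → Measurable (H.newPackets t)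
  measurable_cum : ∀ t, 1 ≤ t → Measurable (H.cumPackets t)
  measurable_intra : ∀ t, 1 ≤ t → Measurable (H.intra t)
  new_law : ∀ t, 1 ≤ t →
    Pr.map (H.newPackets t) = poissonMeasure (net.μNew t).toNNReal
  cum_law : ∀ t, 1 ≤ t →
    Pr.map (H.cumPackets t) = poissonMeasure (H.μCum net i sch Pr t).toNNReal
  indep_packets : ∀ t, 1 ≤ t → IndepFun (H.newPackets t) (H.cumPackets t) Pr
  intra_law : ∀ t, 1 ≤ t → ∀ n : ℕ,
    Pr {ω | H.intra t ω = n} =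
      ∫⁻ a, poissonMeasure (H.activeDensity net i sch Pr t * a).toNNReal {n}
        ∂(gammaMeasure (cellConst + 1) (cellConst * net.lamB))
  device_law : ∀ t, 1 ≤ t → ∀ m : ℕ,
    (H.device t m).HasModelLaw net i (H.activeDensity net i sch Pr t) Pr

end History

/-! ### The closed forms -/

/-- Lower incomplete gamma function. -/
def lowerGamma (a b : ℝ) : ℝ := ∫ t in (0 : ℝ)..b, t ^ (a - 1) * Real.exp (-t)

/-- `O[n, t]` for the activity `y = 𝒜ᵗ ℛᵗ`. -/
def bigO (net : Network) (i : Fin 3) (y : ℝ) (n : ℕ) : ℝ :=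
  cellConst ^ (cellConst + 1) * Real.Gamma (n + cellConst + 1)
      * (y * net.lamA i / net.lamB) ^ n
    / (Real.Gamma (cellConst + 1) * Real.Gamma (n + 1)
      * (y * net.lamA i / net.lamB + cellConst) ^ (n + cellConst + 1))

/-- `ℱ₀` for `l` symbol groups. -/
def F₀ (net : Network) (l : ℕ) : ℝ :=
  ∫ y in Set.Ioi (net.γth ^ (-1 / net.α)), (1 - (1 / (1 + y ^ (-net.α))) ^ l) * y

/-- `ℱ` with lower limit `D`, for `l` symbol groups and link distance `r`. -/
def F (net : Network) (D : ℝ) (l : ℕ) (r : ℝ) : ℝ :=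
  ∫ y in Set.Ioi D, (1 - (1 / (1 + net.γth * r ^ net.α * y ^ (-net.α))) ^ l) * y

/-- Density at `r` of the uniform law in the annulus of radii `a` and `b`, as a function of the
distance from the centre. -/
def annulusPDF (a b r : ℝ) : ℝ := 2 * r / (b ^ 2 - a ^ 2)

/-- Density at `r` of the distance to the nearest BS, given that it exceeds `D₁`. -/
def voronoiPDF (net : Network) (r : ℝ) : ℝ :=
  2 * Real.pi * net.lamB * r * Real.exp (-(net.lamB * Real.pi * (r ^ 2 - net.D₁ ^ 2)))

/-- The factor that multiplies `f_R(r)` under the integral, in groups 1 and 2. -/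
def linkFactor (net : Network) (i : Fin 3) (y D : ℝ) (l : ℕ) (r : ℝ) : ℝ :=
  Real.exp (-(l * net.γth * net.noise * r ^ net.α / net.P))
    * Real.exp (-(2 * Real.pi * (y * net.lamA i) * F net D l r))

/-- Probability that the `l` symbol groups of `k = l / 4` given repetitions are all received. -/
def allReceived (net : Network) (i : Fin 3) (y : ℝ) (l : ℕ) : ℝ :=
  match i with
  | 0 => Real.exp (-(l * net.γth * net.noise / net.ρ)
      - 2 * net.γth ^ (2 / net.α) * (y * net.lamA 0)
          * lowerGamma 2 (Real.pi * net.lamB * (net.P / net.ρ) ^ (2 / net.α))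
        / (net.lamB * (1 - Real.exp (-(Real.pi * net.lamB * (net.P / net.ρ) ^ (2 / net.α)))))
        * F₀ net l)
  | 1 => ∫ r in net.D₀..net.D₁,
      linkFactor net 1 y net.D₁ l r * annulusPDF net.D₀ net.D₁ r
  | 2 => match net.outer with
    | .fixedRadius => ∫ r in net.D₁..net.D₂,
        linkFactor net 2 y net.D₂ l r * annulusPDF net.D₁ net.D₂ r
    | .voronoiCell => ∫ r in Set.Ioi net.D₁,
        linkFactor net 2 y net.D₁ l r * voronoiPDF net r

/-- `Θ[K_i, t]` for the activity `y = 𝒜ᵗ ℛᵗ`. -/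
def bigTheta (net : Network) (i : Fin 3) (y : ℝ) : ℝ :=
  ∑ k ∈ Finset.Icc 1 (net.K i),
    (-1 : ℝ) ^ (k + 1) * ((net.K i).choose k : ℝ) * allReceived net i y (4 * k)

end NBIoT

end

noncomputable section

namespace NBIoT

/-! ### The function `x ↦ exp (-x)` on `[0, ∞]` -/

/-! Fix a set of `k` repetitions and condition on the position of the device and on the field of
active devices. An `Exp(1)` gain has tail `exp (-x)`, so the probability that all `l = 4k` SINRs
reach the threshold is a noise factor times `exp (-s I)`, where `I` is the total interference over
the `l` symbol groups and `s` is the threshold divided by the mean received power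
(`gainLaw_sinrSet`). Averaging over the field leaves a Laplace transform, which the Laplace
functional of a Poisson process evaluates (`IsPoissonProcess.laplace`). Integrating out the
interferers' gains gives `(1 / (1 + s p ‖y‖ ^ (-α))) ^ l` (`laplace_interference`). The repetitions
share one field, so they are dependent, and the power `l` stays inside the spatial integral. Polar
coordinates produce `F`; in group 0 a scaling extracts the square of the link distance and leaves
`F₀` and a truncated second moment. Inclusion–exclusion over repetitions then gives `bigTheta`.

The number of intra-group interferers is a Poisson variable mixed over a gamma law, hence `bigO`.
All devices have the same reception probability, so conditioning on this number gives the series.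

The iteration formulas are mostly the model itself, with one real obstacle: Poisson means and
densities are truncated at zero in the model, so the closed forms require `0 ≤ μCum` and `0 ≤ A *
R`. Under back-off `R` is defined by a subtraction and its sign is not evident; `backoff_nonneg`
settles this by a sliding-window induction.

Laplace transforms are computed in `[0, ∞]` with `expNeg ∞ = 0`, so finiteness of the interference
never has to be proved. -/

/-- The function `x ↦ exp (-x)` on `[0, ∞]`, with value `0` at `∞`. -/
def expNeg (a : ℝ≥0∞) : ℝ≥0∞ := EReal.exp (-(a : EReal))

@[simp] lemma expNeg_zero : expNeg 0 = 1 := by simp [expNeg]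

@[simp] lemma expNeg_top : expNeg ∞ = 0 := by simp [expNeg]

lemma expNeg_ofReal {x : ℝ} (hx : 0 ≤ x) :
    expNeg (ENNReal.ofReal x) = ENNReal.ofReal (Real.exp (-x)) := by
  rw [expNeg, EReal.coe_ennreal_ofReal, max_eq_left hx, ← EReal.coe_neg, EReal.exp_coe]

lemma expNeg_add (a b : ℝ≥0∞) : expNeg (a + b) = expNeg a * expNeg b := by
  rw [expNeg, expNeg, expNeg, ← EReal.exp_add, EReal.coe_ennreal_add, EReal.neg_add,
    sub_eq_add_neg]
  · left; simp
  · right; simp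

lemma expNeg_sum {ι : Type*} (s : Finset ι) (f : ι → ℝ≥0∞) :
    expNeg (∑ i ∈ s, f i) = ∏ i ∈ s, expNeg (f i) := by
  classical
  induction s using Finset.induction_on with
  | empty => simp
  | insert a s ha ih => rw [Finset.sum_insert ha, Finset.prod_insert ha, expNeg_add, ih]

lemma expNeg_antitone : Antitone expNeg := fun _ _ h =>
  EReal.exp_monotone (EReal.neg_le_neg_iff.2 (EReal.coe_ennreal_le_coe_ennreal_iff.2 h))

lemma expNeg_le_one (a : ℝ≥0∞) : expNeg a ≤ 1 := by
  simpa using expNeg_antitone (zero_le (a := a))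

lemma continuous_expNeg : Continuous expNeg :=
  ENNReal.continuous_exp.comp (continuous_neg.comp continuous_coe_ennreal_ereal)

@[fun_prop] lemma measurable_expNeg : Measurable expNeg := continuous_expNeg.measurable

/-! ### The Laplace functional of a Poisson process -/

/-- Summing the exponential series with `m` replaced by `m * exp (-c)` gives the Laplace transform
of a Poisson variable. -/
lemma lintegral_expNeg_mul_poissonMeasure (m c : ℝ≥0) :
    ∫⁻ n : ℕ, expNeg (c * n) ∂(poissonMeasure m) = expNeg ((1 - expNeg c) * m) := by
  have hc : expNeg c = ENNReal.ofReal (Real.exp (-c)) := by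
    rw [← expNeg_ofReal c.coe_nonneg, ENNReal.ofReal_coe_nnreal]
  have h1 : (1 - expNeg c) * m = ENNReal.ofReal ((1 - Real.exp (-c)) * m) := by
    rw [hc, ENNReal.ofReal_mul, ENNReal.ofReal_coe_nnreal, ENNReal.ofReal_sub _ (by positivity),
      ENNReal.ofReal_one]
    simp
  rw [h1, expNeg_ofReal (mul_nonneg (by simp) m.coe_nonneg), poissonMeasure,
    lintegral_sum_measure]
  have h2 : ∀ n : ℕ, ∫⁻ k : ℕ, expNeg (c * k) ∂(ENNReal.ofReal (Real.exp (-m) * m ^ n / n.factorial) •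
      Measure.dirac n) = ENNReal.ofReal (Real.exp (-m) * ((m * Real.exp (-c)) ^ n / n.factorial)) := by
    intro n
    rw [lintegral_smul_measure, lintegral_dirac, smul_eq_mul]
    have : (c : ℝ≥0∞) * n = ENNReal.ofReal (c * n) := by
      rw [ENNReal.ofReal_mul c.coe_nonneg, ENNReal.ofReal_coe_nnreal, ENNReal.ofReal_natCast]
    rw [this, expNeg_ofReal (by positivity), ← ENNReal.ofReal_mul (by positivity), mul_pow,
      ← Real.exp_nat_mul]
    congr 1
    rw [show -((c : ℝ) * n) = n * -(c : ℝ) by ring]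
    ring
  simp_rw [h2]
  have h3 : HasSum (fun n : ℕ => Real.exp (-m) * ((m * Real.exp (-c)) ^ n / n.factorial))
      (Real.exp (-m) * Real.exp (m * Real.exp (-c))) := by
    refine HasSum.mul_left _ ?_
    rw [Real.exp_eq_exp_ℝ]
    exact NormedSpace.expSeries_div_hasSum_exp _
  rw [← ENNReal.ofReal_tsum_of_nonneg (fun n => by positivity) h3.summable, h3.tsum_eq,
    ← Real.exp_add]
  congr 2
  ring

section Laplace

variable {Ω E : Type*} [MeasurableSpace Ω] [MeasurableSpace E] {Pr : Measure Ω}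
  {Φ : Ω → Measure E} {Λ : Measure E}

lemma IsPoissonProcess.lintegral_expNeg_mul (h : IsPoissonProcess Pr Φ Λ) {B : Set E}
    (hB : MeasurableSet B) (hΛ : Λ B ≠ ∞) (c : ℝ≥0) :
    ∫⁻ ω, expNeg (c * Φ ω B) ∂Pr = expNeg ((1 - expNeg c) * Λ B) := by
  have hm : Measurable fun ω => Φ ω B := (Measure.measurable_coe hB).comp h.measurable
  have h1 := lintegral_map (μ := Pr) (f := fun x => expNeg (c * x)) (by fun_prop) hm
  rw [← h1, h.count_law B hB hΛ, lintegral_map (by fun_prop) (by fun_prop),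
    lintegral_expNeg_mul_poissonMeasure, ENNReal.coe_toNNReal hΛ]

/-- The integral of a simple function is a finite combination of counts on its level sets. These are
disjoint, so the counts are independent and the transform factorizes. Only nonzero levels need
finite intensity, because the zero level contributes the factor 1. -/
lemma IsPoissonProcess.laplace_simpleFunc [IsProbabilityMeasure Pr] (h : IsPoissonProcess Pr Φ Λ)
    (g : SimpleFunc E ℝ≥0∞) (htop : ∀ x, g x ≠ ∞) (hfin : ∀ c, c ≠ 0 → Λ (g ⁻¹' {c}) ≠ ∞) :
    ∫⁻ ω, expNeg (∫⁻ x, g x ∂(Φ ω)) ∂Pr = expNeg (∫⁻ x, (1 - expNeg (g x)) ∂Λ) := by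
  have h1 : ∀ ω, expNeg (∫⁻ x, g x ∂(Φ ω)) =
      ∏ c : g.range, expNeg (c * Φ ω (g ⁻¹' {(c : ℝ≥0∞)})) := by
    intro ω
    rw [SimpleFunc.lintegral_eq_lintegral, SimpleFunc.lintegral, expNeg_sum,
      ← Finset.prod_coe_sort]
  have h2 : ∫⁻ x, (1 - expNeg (g x)) ∂Λ =
      ∑ c : g.range, (1 - expNeg c) * Λ (g ⁻¹' {(c : ℝ≥0∞)}) := by
    have := SimpleFunc.map_lintegral (μ := Λ) (fun c => 1 - expNeg c) g
    rw [← SimpleFunc.lintegral_eq_lintegral, ← Finset.sum_coe_sort] at this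
    rw [← this]
    rfl
  have hind : iIndepFun (fun (c : g.range) ω => expNeg (c * Φ ω (g ⁻¹' {(c : ℝ≥0∞)}))) Pr := by
    have e := Fintype.equivFin g.range
    have h3 := h.indep _ (fun k => g ⁻¹' {((e.symm k : g.range) : ℝ≥0∞)})
      (fun k => g.measurableSet_preimage _) (by
        intro k l hkl
        refine Disjoint.preimage _ (Set.disjoint_singleton.2 fun h' => hkl ?_)
        exact e.symm.injective (Subtype.ext h'))
    have h4 := h3.precomp e.injective
    simp only [Equiv.symm_apply_apply] at h4
    exact h4.comp (fun (c : g.range) x => expNeg (c * x)) (fun c => by fun_prop)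
  simp_rw [h1]
  rw [lintegral_prod_eq_prod_lintegral_of_indepFun Finset.univ _ hind, h2, expNeg_sum]
  · refine Finset.prod_congr rfl fun c _ => ?_
    by_cases hc : (c : ℝ≥0∞) = 0
    · simp [hc]
    · obtain ⟨x, hx⟩ := SimpleFunc.mem_range.1 c.2
      have hct : (c : ℝ≥0∞) ≠ ∞ := hx ▸ htop x
      have := h.lintegral_expNeg_mul (g.measurableSet_preimage {(c : ℝ≥0∞)}) (hfin c hc)
        (c : ℝ≥0∞).toNNReal
      rwa [ENNReal.coe_toNNReal hct] at this
  · intro c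
    have : Measurable fun ω => Φ ω (g ⁻¹' {(c : ℝ≥0∞)}) :=
      (Measure.measurable_coe (g.measurableSet_preimage _)).comp h.measurable
    fun_prop

/-- **Laplace functional** of a Poisson process. -/
theorem IsPoissonProcess.laplace [IsProbabilityMeasure Pr] [SigmaFinite Λ]
    (h : IsPoissonProcess Pr Φ Λ) {f : E → ℝ≥0∞} (hf : Measurable f) :
    ∫⁻ ω, expNeg (∫⁻ x, f x ∂(Φ ω)) ∂Pr = expNeg (∫⁻ x, (1 - expNeg (f x)) ∂Λ) := by
  -- Cutting off to the spanning sets makes every nonzero level set of finite intensity. Each point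
  -- eventually lies in them, so the limit is still `f`.
  let g : ℕ → SimpleFunc E ℝ≥0∞ := fun n => (SimpleFunc.eapprox f n).restrict (spanningSets Λ n)
  have hg : ∀ n x, g n x = (spanningSets Λ n).indicator (SimpleFunc.eapprox f n) x := fun n x =>
    SimpleFunc.restrict_apply _ (measurableSet_spanningSets Λ n) x
  have hmono : ∀ x, Monotone fun n => g n x := by
    intro x m n hmn
    simp only [hg]
    refine (Set.indicator_le_indicator (SimpleFunc.monotone_eapprox f hmn x)).trans ?_
    exact Set.indicator_le_indicator_of_subset (monotone_spanningSets Λ hmn) (fun _ => zero_le) x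
  have hlim : ∀ x, Filter.Tendsto (fun n => g n x) Filter.atTop (nhds (f x)) := by
    intro x
    refine (SimpleFunc.tendsto_eapprox hf x).congr' ?_
    filter_upwards [Filter.eventually_ge_atTop (spanningSetsIndex Λ x)] with n hn
    rw [hg, Set.indicator_of_mem]
    exact monotone_spanningSets Λ hn (mem_spanningSetsIndex Λ x)
  have key : ∀ n, ∫⁻ ω, expNeg (∫⁻ x, g n x ∂(Φ ω)) ∂Pr = expNeg (∫⁻ x, (1 - expNeg (g n x)) ∂Λ) := by
    intro n
    refine h.laplace_simpleFunc (g n) (fun x => ?_) (fun c hc => ?_)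
    · rw [hg]
      by_cases hx : x ∈ spanningSets Λ n
      · rw [Set.indicator_of_mem hx]
        exact (SimpleFunc.eapprox_lt_top f n x).ne
      · simp [hx]
    · refine ((measure_mono fun x hx => ?_).trans_lt (measure_spanningSets_lt_top Λ n)).ne
      by_contra hx'
      have : g n x = c := hx
      rw [hg, Set.indicator_of_notMem hx'] at this
      exact hc this.symm
  -- The integrands decrease in `n`, so dominated convergence with bound 1 is used here; on the
  -- intensity side `1 - expNeg` increases and monotone convergence applies.
  have hL : Filter.Tendsto (fun n => ∫⁻ ω, expNeg (∫⁻ x, g n x ∂(Φ ω)) ∂Pr) Filter.atTop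
      (nhds (∫⁻ ω, expNeg (∫⁻ x, f x ∂(Φ ω)) ∂Pr)) := by
    refine tendsto_lintegral_of_dominated_convergence (fun _ => 1) (fun n => ?_) (fun n => ?_)
      (by simp) (Filter.Eventually.of_forall fun ω => ?_)
    · exact measurable_expNeg.comp ((Measure.measurable_lintegral (g n).measurable).comp h.measurable)
    · exact Filter.Eventually.of_forall fun ω => expNeg_le_one _
    · refine (continuous_expNeg.tendsto _).comp ?_
      exact lintegral_tendsto_of_tendsto_of_monotone (fun n => (g n).measurable.aemeasurable)
        (Filter.Eventually.of_forall hmono) (Filter.Eventually.of_forall hlim)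
  have hR : Filter.Tendsto (fun n => expNeg (∫⁻ x, (1 - expNeg (g n x)) ∂Λ)) Filter.atTop
      (nhds (expNeg (∫⁻ x, (1 - expNeg (f x)) ∂Λ))) := by
    refine (continuous_expNeg.tendsto _).comp ?_
    refine lintegral_tendsto_of_tendsto_of_monotone (fun n => ?_)
      (Filter.Eventually.of_forall fun x m n hmn => ?_) (Filter.Eventually.of_forall fun x => ?_)
    · have := (g n).measurable
      fun_prop
    · exact tsub_le_tsub_left (expNeg_antitone (hmono x hmn)) 1
    · exact ENNReal.Tendsto.sub tendsto_const_nhds ((continuous_expNeg.tendsto _).comp (hlim x))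
        (Or.inl (by simp))
  exact tendsto_nhds_unique hL (by simpa only [key] using hR)

end Laplace

/-! ### Rayleigh fading -/

lemma lintegral_expMeasure_one (f : ℝ → ℝ≥0∞) :
    ∫⁻ x, f x ∂(expMeasure 1) = ∫⁻ x in Set.Ioi 0, ENNReal.ofReal (Real.exp (-x)) * f x := by
  have hm : Measurable (gammaPDF 1 1) := (measurable_gammaPDFReal 1 1).ennreal_ofReal
  rw [expMeasure, gammaMeasure, lintegral_withDensity_eq_lintegral_mul_non_measurable _ hm
    (Filter.Eventually.of_forall fun x => by simp [gammaPDF]), ← lintegral_indicator measurableSet_Ioi]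
  refine lintegral_congr_ae ?_
  filter_upwards [Measure.ae_ne volume (0 : ℝ)] with x hx
  rcases lt_or_gt_of_ne hx with h | h
  · simp [gammaPDF_of_neg h, h.le]
  · simp [gammaPDF_of_nonneg h.le, h]

instance : IsProbabilityMeasure (expMeasure 1) := isProbabilityMeasure_expMeasure one_pos

instance (K : ℕ) : IsProbabilityMeasure (gainLaw K) := by unfold gainLaw; infer_instance

/-- This exact exponential tail is what turns an SINR event into a Laplace transform. The value `c =
∞` covers infinite interference. -/
lemma expMeasure_one_le (c : ℝ≥0∞) : expMeasure 1 {h | c ≤ ENNReal.ofReal h} = expNeg c := by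
  induction c with
  | top => simp
  | coe t =>
    have hms : MeasurableSet {h | (t : ℝ≥0∞) ≤ ENNReal.ofReal h} :=
      measurableSet_le measurable_const (by fun_prop)
    rw [← lintegral_indicator_one hms, lintegral_expMeasure_one, ← ENNReal.ofReal_coe_nnreal,
      expNeg_ofReal t.coe_nonneg, ← integral_exp_neg_Ioi, ofReal_integral_eq_lintegral_ofReal
        (integrableOn_exp_neg_Ioi _) (Filter.Eventually.of_forall fun _ => Real.exp_nonneg _),
      ← lintegral_indicator measurableSet_Ioi, ← lintegral_indicator measurableSet_Ioi]
    refine lintegral_congr_ae ?_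
    filter_upwards [Measure.ae_ne volume (t : ℝ)] with x hx
    by_cases h0 : 0 < x
    · rcases lt_or_gt_of_ne hx with h | h
      · have h' : ¬ (ENNReal.ofReal (t : ℝ) ≤ ENNReal.ofReal x) := by
          rw [not_le]; exact (ENNReal.ofReal_lt_ofReal_iff (h0.trans h)).2 h
        rw [ENNReal.ofReal_coe_nnreal] at h'
        simp [Set.indicator, h0, h', h.le]
      · have h' := ENNReal.ofReal_le_ofReal h.le
        rw [ENNReal.ofReal_coe_nnreal] at h'
        simp [Set.indicator, h0, h, h']
    · have : ¬ (t : ℝ) < x := fun h => h0 (t.coe_nonneg.trans_lt h)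
      simp [Set.indicator, h0, this]

lemma lintegral_expNeg_mul_expMeasure_one {t : ℝ} (ht : 0 ≤ t) :
    ∫⁻ h, expNeg (ENNReal.ofReal (t * h)) ∂(expMeasure 1) = ENNReal.ofReal (1 / (1 + t)) := by
  have h1 : ∫ x in Set.Ioi (0 : ℝ), Real.exp (-(1 + t) * x) = 1 / (1 + t) := by
    rw [integral_exp_mul_Ioi (by linarith), mul_zero, Real.exp_zero, neg_div_neg_eq]
  rw [lintegral_expMeasure_one, ← h1, ofReal_integral_eq_lintegral_ofReal
        (integrableOn_exp_mul_Ioi (by linarith) _)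
        (Filter.Eventually.of_forall fun _ => Real.exp_nonneg _)]
  refine setLIntegral_congr_fun measurableSet_Ioi fun x hx => ?_
  have hx : 0 < x := hx
  rw [expNeg_ofReal (by positivity), ← ENNReal.ofReal_mul (Real.exp_nonneg _), ← Real.exp_add]
  congr 2
  ring

/-- The event is a box, constrained only in the coordinates of `T`, so the product measure
factorizes. -/
lemma gainLaw_box {K : ℕ} (T : Finset (Fin K × Fin 4)) (c : Fin K × Fin 4 → ℝ≥0∞) :
    gainLaw K {h | ∀ j ∈ T, c j ≤ ENNReal.ofReal (h j)} = ∏ j ∈ T, expNeg (c j) := by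
  classical
  have : {h : Gains K | ∀ j ∈ T, c j ≤ ENNReal.ofReal (h j)} =
      Set.univ.pi fun j => if j ∈ T then {h | c j ≤ ENNReal.ofReal h} else Set.univ := by
    ext h
    simp only [Set.mem_ofPred_eq, Set.mem_univ_pi]
    refine forall_congr' fun j => ?_
    split_ifs with hj <;> simp [hj]
  rw [this, gainLaw, Measure.pi_pi, ← Finset.prod_subset (Finset.subset_univ T)]
  · exact Finset.prod_congr rfl fun j hj => by rw [if_pos hj, expMeasure_one_le]
  · intro j _ hj
    rw [if_neg hj, measure_univ]

lemma lintegral_expNeg_sum_gainLaw {K : ℕ} (T : Finset (Fin K × Fin 4)) {t : ℝ} (ht : 0 ≤ t) :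
    ∫⁻ h, expNeg (∑ j ∈ T, ENNReal.ofReal (t * h j)) ∂(gainLaw K) =
      ENNReal.ofReal ((1 / (1 + t)) ^ T.card) := by
  simp_rw [expNeg_sum]
  have hind : iIndepFun (fun (j : Fin K × Fin 4) (h : Gains K) =>
      expNeg (ENNReal.ofReal (t * h j))) (gainLaw K) :=
    iIndepFun_pi (X := fun _ x => expNeg (ENNReal.ofReal (t * x))) (fun j => by fun_prop)
  rw [lintegral_prod_eq_prod_lintegral_of_indepFun T _ hind (fun j => by fun_prop),
    ENNReal.ofReal_pow (by positivity), ← Finset.prod_const]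
  refine Finset.prod_congr rfl fun j _ => ?_
  rw [← lintegral_expNeg_mul_expMeasure_one ht]
  exact (measurePreserving_eval (fun _ : Fin K × Fin 4 => expMeasure 1) j).lintegral_comp
    (f := fun x => expNeg (ENNReal.ofReal (t * x))) (by fun_prop)

/-! ### Integrals of radial functions in the plane -/

/-- Polar coordinates: the punctured plane is the unit circle times `(0, ∞)` with radial weight `r`,
and the circle has mass twice the area of the unit disc. -/
lemma lintegral_fun_norm_plane {f : ℝ → ℝ≥0∞} (hf : Measurable f) :
    ∫⁻ x : Plane, f ‖x‖ =
      ENNReal.ofReal (2 * Real.pi) * ∫⁻ r in Set.Ioi 0, ENNReal.ofReal r * f r := by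
  have hdim : Module.finrank ℝ Plane = 2 := by simp
  calc
    ∫⁻ x : Plane, f ‖x‖ = ∫⁻ x : ({(0)}ᶜ : Set Plane), f (‖x.1‖) ∂((volume : Measure Plane).comap Subtype.val) := by
      rw [lintegral_subtype_comap (measurableSet_singleton _).compl fun x : Plane ↦ f (‖x‖),
        restrict_compl_singleton]
    _ = ∫⁻ x, f x.2 ∂(volume : Measure Plane).toSphere.prod
          (.volumeIoiPow (Module.finrank ℝ Plane - 1)) := by
      simpa using (volume : Measure Plane).measurePreserving_homeomorphUnitSphereProd.lintegral_comp_emb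
        (Homeomorph.measurableEmbedding _) (f ∘ Subtype.val ∘ Prod.snd)
    _ = (volume : Measure Plane).toSphere Set.univ *
          ∫⁻ x : Set.Ioi (0 : ℝ), f x ∂.volumeIoiPow (Module.finrank ℝ Plane - 1) := by
      rw [lintegral_prod _ (by fun_prop)]
      simp [mul_comm]
    _ = _ := by
      rw [Measure.volumeIoiPow, lintegral_withDensity_eq_lintegral_mul _ (by fun_prop) (by fun_prop),
        Measure.toSphere_apply_univ, hdim]
      congr 1
      · rw [EuclideanSpace.volume_ball_fin_two]
        simp [ENNReal.ofReal_mul]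
      · simp only [Pi.mul_apply]
        rw [lintegral_subtype_comap measurableSet_Ioi fun a ↦ ENNReal.ofReal (a ^ (2 - 1)) * f a]
        simp

/-- Bounds for the integrands of `F` and `F₀`, up to the factor `y`. -/
lemma one_sub_pow_mem {u : ℝ} (hu : 0 ≤ u) (l : ℕ) :
    0 ≤ 1 - (1 / (1 + u)) ^ l ∧ 1 - (1 / (1 + u)) ^ l ≤ l * u := by
  have h1 : 1 / (1 + u) ≤ 1 := by
    rw [div_le_one (by linarith)]; linarith
  have h0 : 0 ≤ 1 / (1 + u) := by positivity
  refine ⟨by linarith [pow_le_one₀ (n := l) h0 h1], ?_⟩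
  -- Bernoulli's inequality, applied to `1 / (1 + u) = 1 + (1 / (1 + u) - 1)`.
  have h2 := one_add_mul_le_pow (a := 1 / (1 + u) - 1) (by linarith) l
  rw [add_sub_cancel] at h2
  have h3 : 1 - 1 / (1 + u) ≤ u := by
    rw [sub_le_iff_le_add, ← sub_le_iff_le_add', le_div_iff₀ (by linarith)]
    nlinarith
  nlinarith [mul_le_mul_of_nonneg_left h3 (Nat.cast_nonneg (α := ℝ) l)]

/-- The integrand is at most `l * b * y ^ (1 - α)`, which is integrable at infinity precisely
because `α > 2`. -/
lemma integrableOn_pathLoss {α b D : ℝ} (hα : 2 < α) (hb : 0 ≤ b) (hD : 0 < D) (l : ℕ) :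
    IntegrableOn (fun y : ℝ => (1 - (1 / (1 + b * y ^ (-α))) ^ l) * y) (Set.Ioi D) := by
  have h1 : IntegrableOn (fun y : ℝ => l * b * y ^ (1 - α)) (Set.Ioi D) :=
    (integrableOn_Ioi_rpow_of_lt (by linarith) hD).const_mul _
  refine h1.mono' (by fun_prop) ?_
  refine (ae_restrict_iff' measurableSet_Ioi).2 (Filter.Eventually.of_forall fun y hy => ?_)
  have hy0 : 0 < y := hD.trans hy
  obtain ⟨h2, h3⟩ := one_sub_pow_mem (u := b * y ^ (-α)) (by positivity) l
  rw [Real.norm_eq_abs, abs_of_nonneg (by positivity), sub_eq_add_neg 1 α, Real.rpow_add hy0,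
    Real.rpow_one]
  nlinarith

lemma lintegral_pathLoss {α b D : ℝ} (hα : 2 < α) (hb : 0 ≤ b) (hD : 0 < D) (l : ℕ) :
    ∫⁻ x in {x : Plane | D < ‖x‖}, ENNReal.ofReal (1 - (1 / (1 + b * ‖x‖ ^ (-α))) ^ l) =
      ENNReal.ofReal (2 * Real.pi *
        ∫ y in Set.Ioi D, (1 - (1 / (1 + b * y ^ (-α))) ^ l) * y) := by
  have hms : MeasurableSet {x : Plane | D < ‖x‖} := measurableSet_lt measurable_const (by fun_prop)
  rw [← lintegral_indicator hms]
  have := lintegral_fun_norm_plane (f := (Set.Ioi D).indicator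
    fun r => ENNReal.ofReal (1 - (1 / (1 + b * r ^ (-α))) ^ l))
    ((by fun_prop : Measurable _).indicator measurableSet_Ioi)
  rw [ENNReal.ofReal_mul (by positivity), ofReal_integral_eq_lintegral_ofReal
    (integrableOn_pathLoss hα hb hD l)]
  · refine Eq.trans ?_ (this.trans ?_)
    · rfl
    · congr 1
      rw [← lintegral_indicator measurableSet_Ioi, ← lintegral_indicator measurableSet_Ioi]
      refine lintegral_congr fun r => ?_
      by_cases hr : D < r
      · have hr0 : 0 < r := hD.trans hr
        have := (one_sub_pow_mem (u := b * r ^ (-α)) (by positivity) l).1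
        rw [Set.indicator_of_mem (show r ∈ Set.Ioi 0 from hr0),
          Set.indicator_of_mem (show r ∈ Set.Ioi D from hr),
          Set.indicator_of_mem (show r ∈ Set.Ioi D from hr), ENNReal.ofReal_mul this, mul_comm]
      · simp [Set.indicator, hr]
  · refine (ae_restrict_iff' measurableSet_Ioi).2 (Filter.Eventually.of_forall fun y hy => ?_)
    have hy0 : 0 < y := hD.trans hy
    have := (one_sub_pow_mem (u := b * y ^ (-α)) (by positivity) l).1
    positivity

/-! ### Reception of a preamble in given repetitions -/

/-- Isolates the gain, making the event a tail event. Positive noise keeps the denominator nonzero,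
so the rearrangement also holds for `I = ∞`. -/
lemma le_sinr_iff {γ w h σ : ℝ} (hw : 0 < w) (hσ : 0 < σ) (I : ℝ≥0∞) :
    ENNReal.ofReal γ ≤ ENNReal.ofReal (w * h) / (I + ENNReal.ofReal σ) ↔
      ENNReal.ofReal (γ / w) * (I + ENNReal.ofReal σ) ≤ ENNReal.ofReal h := by
  have h0 : I + ENNReal.ofReal σ ≠ 0 := by simp [hσ]
  have hw0 : ENNReal.ofReal w ≠ 0 := by simp [hw]
  rw [ENNReal.le_div_iff_mul_le (Or.inl h0) (Or.inr ENNReal.ofReal_ne_top),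
    ENNReal.ofReal_mul hw.le, ENNReal.ofReal_div_of_pos hw, mul_comm (ENNReal.ofReal w),
    ← ENNReal.div_le_iff_le_mul (Or.inl hw0) (Or.inl ENNReal.ofReal_ne_top), div_eq_mul_inv,
    div_eq_mul_inv]
  ring_nf

@[fun_prop] lemma measurable_txPower (net : Network) (i : Fin 3) : Measurable (txPower net i) := by
  fin_cases i
  · change Measurable fun r : ℝ => net.ρ * r ^ net.α
    fun_prop
  · exact measurable_const
  · exact measurable_const

@[fun_prop] lemma measurable_exclusionRadius (net : Network) (i : Fin 3) :
    Measurable (exclusionRadius net i) := by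
  fin_cases i
  · change Measurable fun p : ℝ => (p / net.ρ) ^ (1 / net.α)
    fun_prop
  · exact measurable_const
  · exact measurable_const

lemma txPower_pos (net : Network) (i : Fin 3) {r : ℝ} (hr : 0 < r) : 0 < txPower net i r := by
  have := net.ρ_pos
  have := net.P_pos
  fin_cases i
  · change 0 < net.ρ * r ^ net.α
    positivity
  · assumption
  · assumption

/-- The part of the plane, with marks, in which a point is an interferer. -/
def interfererSet (net : Network) (i : Fin 3) : Set (Interferer (net.K i)) :=
  {z | exclusionRadius net i z.2.1 < ‖z.1‖}

lemma measurableSet_interfererSet (net : Network) (i : Fin 3) :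
    MeasurableSet (interfererSet net i) :=
  measurableSet_lt (by fun_prop) (by fun_prop)

/-- Power received from a point of the field in one symbol group. -/
def rxPower (net : Network) (i : Fin 3) (j : Fin (net.K i) × Fin 4)
    (z : Interferer (net.K i)) : ℝ :=
  z.2.1 * z.2.2 j * ‖z.1‖ ^ (-net.α)

@[fun_prop] lemma measurable_rxPower (net : Network) (i : Fin 3) (j : Fin (net.K i) × Fin 4) :
    Measurable (rxPower net i j) := by
  unfold rxPower
  fun_prop

/-- Aggregate interference as a function of the configuration of points. -/
def fieldPower (net : Network) (i : Fin 3) (j : Fin (net.K i) × Fin 4)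
    (φ : Measure (Interferer (net.K i))) : ℝ≥0∞ :=
  ∫⁻ z in interfererSet net i, ENNReal.ofReal (rxPower net i j z) ∂φ

@[fun_prop] lemma measurable_fieldPower (net : Network) (i : Fin 3) (j : Fin (net.K i) × Fin 4) :
    Measurable (fieldPower net i j) := by
  unfold fieldPower
  simp_rw [← lintegral_indicator (measurableSet_interfererSet net i)]
  exact Measure.measurable_lintegral
    ((by fun_prop : Measurable _).indicator (measurableSet_interfererSet net i))

/-- Ratio of the SINR threshold and the mean received power of a device at distance `r`. -/
def relThreshold (net : Network) (i : Fin 3) (r : ℝ) : ℝ :=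
  net.γth / (txPower net i r * r ^ (-net.α))

lemma measurable_relThreshold (net : Network) (i : Fin 3) : Measurable (relThreshold net i) := by
  unfold relThreshold
  fun_prop

lemma relThreshold_pos (net : Network) (i : Fin 3) {r : ℝ} (hr : 0 < r) :
    0 < relThreshold net i r := by
  have := txPower_pos net i hr
  have := net.γth_pos
  unfold relThreshold
  positivity

section Transmission

variable {Ω : Type*} {net : Network} {i : Fin 3} {x : ℝ} {X : Transmission Ω (net.K i)}

/-- The event that the preamble is received in the `k`-th repetition. -/
def Transmission.receivedIn (net : Network) (i : Fin 3) (X : Transmission Ω (net.K i))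
    (k : Fin (net.K i)) : Set Ω :=
  {ω | ∀ b : Fin 4, ENNReal.ofReal net.γth ≤ X.sinr net i k b ω}

/-- The values of gains, position and field for which the SINR reaches the threshold in all symbol
groups of `T`. -/
def sinrSet (net : Network) (i : Fin 3) (T : Finset (Fin (net.K i) × Fin 4)) :
    Set (Gains (net.K i) × Plane × Measure (Interferer (net.K i))) :=
  {y | ∀ j ∈ T, ENNReal.ofReal net.γth ≤
    ENNReal.ofReal (txPower net i ‖y.2.1‖ * y.1 j * ‖y.2.1‖ ^ (-net.α)) /
      (fieldPower net i j y.2.2 + ENNReal.ofReal net.noise)}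

lemma measurableSet_sinrSet (T : Finset (Fin (net.K i) × Fin 4)) :
    MeasurableSet (sinrSet net i T) := by
  have : sinrSet net i T = ⋂ j ∈ T, {y | ENNReal.ofReal net.γth ≤
    ENNReal.ofReal (txPower net i ‖y.2.1‖ * y.1 j * ‖y.2.1‖ ^ (-net.α)) /
      (fieldPower net i j y.2.2 + ENNReal.ofReal net.noise)} := by
    ext y; simp [sinrSet]
  rw [this]
  refine Finset.measurableSet_biInter _ fun j _ => measurableSet_le measurable_const ?_
  fun_prop

lemma biInter_receivedIn (T : Finset (Fin (net.K i))) :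
    ⋂ k ∈ T, X.receivedIn net i k =
      (fun ω => (X.gain ω, X.position ω, X.field ω)) ⁻¹' sinrSet net i (T ×ˢ Finset.univ) := by
  ext ω
  simp only [Set.mem_iInter, Set.mem_preimage, sinrSet, Set.mem_ofPred_eq, Finset.mem_product,
    Finset.mem_univ, and_true, Prod.forall]
  exact ⟨fun h k b hk => h k hk b, fun h k hk b => h k b hk⟩

variable [MeasurableSpace Ω] {Pr : Measure Ω}

lemma Transmission.HasModelLaw.measurable_all (hX : X.HasModelLaw net i x Pr) :
    Measurable fun ω => (X.gain ω, X.position ω, X.field ω) :=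
  hX.measurable_gain.prodMk (hX.measurable_position.prodMk hX.field_law.measurable)

lemma Transmission.HasModelLaw.measurableSet_receivedIn (hX : X.HasModelLaw net i x Pr)
    (k : Fin (net.K i)) : MeasurableSet (X.receivedIn net i k) := by
  have := biInter_receivedIn (X := X) {k}
  rw [Finset.set_biInter_singleton] at this
  rw [this]
  exact hX.measurable_all (measurableSet_sinrSet _)

/-- With position and configuration frozen, each symbol group asks its own gain to exceed a
constant. The product of the tails collects noise and interference in one exponent. A device away
from the BS has positive mean received power, which allows the division. -/
lemma gainLaw_sinrSet (T : Finset (Fin (net.K i) × Fin 4)) {p : Plane} (hp : p ≠ 0)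
    (φ : Measure (Interferer (net.K i))) :
    gainLaw (net.K i) ((fun h => (h, p, φ)) ⁻¹' sinrSet net i T) =
      ENNReal.ofReal (Real.exp (-(T.card * relThreshold net i ‖p‖ * net.noise))) *
        expNeg (ENNReal.ofReal (relThreshold net i ‖p‖) * ∑ j ∈ T, fieldPower net i j φ) := by
  have hr : 0 < ‖p‖ := norm_pos_iff.2 hp
  have hs := relThreshold_pos net i hr
  have hσ := net.noise_pos
  have hw : 0 < txPower net i ‖p‖ * ‖p‖ ^ (-net.α) :=
    mul_pos (txPower_pos net i hr) (Real.rpow_pos_of_pos hr _)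
  have h1 : (fun h => (h, p, φ)) ⁻¹' sinrSet net i T = {h : Gains (net.K i) | ∀ j ∈ T,
      ENNReal.ofReal (relThreshold net i ‖p‖) *
        (fieldPower net i j φ + ENNReal.ofReal net.noise) ≤ ENNReal.ofReal (h j)} := by
    ext h
    simp only [sinrSet, Set.mem_preimage, Set.mem_ofPred_eq]
    refine forall₂_congr fun j _ => ?_
    rw [mul_right_comm, le_sinr_iff hw hσ, relThreshold]
  rw [h1, gainLaw_box, ← expNeg_ofReal (by positivity), ← expNeg_add, ← expNeg_sum]
  congr 1
  simp_rw [mul_add]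
  rw [Finset.sum_add_distrib, Finset.mul_sum, Finset.sum_const, nsmul_eq_mul,
    mul_assoc (T.card : ℝ), ENNReal.ofReal_mul (p := (T.card : ℝ)) (by positivity),
    ENNReal.ofReal_mul hs.le, ENNReal.ofReal_natCast]
  ring

variable [IsProbabilityMeasure Pr]

/-- Conditioning on the position of the device: the probability that the preamble is received in
all repetitions of `T`, in terms of the Laplace transform of the aggregate interference. -/
lemma Transmission.HasModelLaw.measure_biInter_receivedIn (hX : X.HasModelLaw net i x Pr)
    (h0 : Pr.map X.position {0} = 0) (T : Finset (Fin (net.K i))) :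
    Pr (⋂ k ∈ T, X.receivedIn net i k) = ∫⁻ p,
      ENNReal.ofReal (Real.exp (-((4 * T.card : ℕ) * relThreshold net i ‖p‖ * net.noise))) *
        ∫⁻ ω, expNeg (ENNReal.ofReal (relThreshold net i ‖p‖) *
          ∑ j ∈ T ×ˢ Finset.univ, fieldPower net i j (X.field ω)) ∂Pr ∂(Pr.map X.position) := by
  have hmY : Measurable fun ω => (X.position ω, X.field ω) :=
    hX.measurable_position.prodMk hX.field_law.measurable
  have := Measure.isProbabilityMeasure_map (μ := Pr) hX.measurable_gain.aemeasurable
  have := Measure.isProbabilityMeasure_map (μ := Pr) hX.measurable_position.aemeasurable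
  have := Measure.isProbabilityMeasure_map (μ := Pr) hX.field_law.measurable.aemeasurable
  have := Measure.isProbabilityMeasure_map (μ := Pr) hmY.aemeasurable
  have hE := measurableSet_sinrSet (net := net) (i := i) (T ×ˢ Finset.univ)
  -- The two independence assumptions make the joint law the product of the laws of gains, position
  -- and field, so the gains can be integrated first.
  have hmap1 := (indepFun_iff_map_prod_eq_prod_map_map hX.measurable_gain.aemeasurable
    hmY.aemeasurable).1 hX.indep_gain
  have hmap2 := (indepFun_iff_map_prod_eq_prod_map_map hX.measurable_position.aemeasurable
    hX.field_law.measurable.aemeasurable).1 hX.indep_position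
  have hmr := measurable_relThreshold net i
  rw [biInter_receivedIn, ← Measure.map_apply hX.measurable_all hE, hmap1,
    Measure.prod_apply_symm hE, hmap2, lintegral_prod _ (by
      exact (measurable_measure_prodMk_right hE).aemeasurable)]
  refine lintegral_congr_ae ?_
  have hne : ∀ᵐ p ∂(Pr.map X.position), p ≠ 0 := measure_eq_zero_iff_ae_notMem.1 h0
  filter_upwards [hne] with p hp
  simp_rw [hX.gain_law]
  have h1 : ∀ φ, gainLaw (net.K i) ((fun h => (h, p, φ)) ⁻¹' sinrSet net i (T ×ˢ Finset.univ)) = _ :=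
    gainLaw_sinrSet _ hp
  simp_rw [h1]
  rw [lintegral_map (by fun_prop) hX.field_law.measurable, lintegral_const_mul]
  · simp [mul_comm]
  · have := hX.field_law.measurable
    fun_prop

/-- Laplace transform of the aggregate interference. -/
lemma Transmission.HasModelLaw.laplace_interference (hX : X.HasModelLaw net i x Pr)
    [IsProbabilityMeasure (powerLaw net i)] (hpow : ∀ᵐ p ∂(powerLaw net i), 0 ≤ p)
    (T : Finset (Fin (net.K i) × Fin 4)) {s : ℝ} (hs : 0 ≤ s) :
    ∫⁻ ω, expNeg (ENNReal.ofReal s * ∑ j ∈ T, fieldPower net i j (X.field ω)) ∂Pr =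
      expNeg (ENNReal.ofReal x * ∫⁻ p, (∫⁻ y in {y : Plane | exclusionRadius net i p < ‖y‖},
        ENNReal.ofReal (1 - (1 / (1 + s * p * ‖y‖ ^ (-net.α))) ^ T.card)) ∂(powerLaw net i)) := by
  -- All symbol groups see the same field, so their weighted interferences are merged into the
  -- integral of a single function and the Laplace functional is applied once.
  set f : Interferer (net.K i) → ℝ≥0∞ := (interfererSet net i).indicator
    fun z => ∑ j ∈ T, ENNReal.ofReal s * ENNReal.ofReal (rxPower net i j z) with hf
  have hfm : Measurable f :=
    (by fun_prop : Measurable _).indicator (measurableSet_interfererSet net i)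
  have hsf : SigmaFinite ((ENNReal.ofReal x • (volume : Measure Plane)).prod
      ((powerLaw net i).prod (gainLaw (net.K i)))) := by
    have : SigmaFinite (ENNReal.ofReal x • (volume : Measure Plane)) :=
      inferInstanceAs (SigmaFinite (x.toNNReal • (volume : Measure Plane)))
    infer_instance
  have h1 : ∀ φ, ENNReal.ofReal s * ∑ j ∈ T, fieldPower net i j φ = ∫⁻ z, f z ∂φ := by
    intro φ
    rw [hf, lintegral_indicator (measurableSet_interfererSet net i),
      lintegral_finsetSum _ (fun j _ => by fun_prop), Finset.mul_sum]
    refine Finset.sum_congr rfl fun j _ => ?_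
    rw [lintegral_const_mul _ (by fun_prop), fieldPower]
  simp_rw [h1]
  rw [hX.field_law.laplace hfm, lintegral_prod _ (by fun_prop), lintegral_smul_measure, smul_eq_mul]
  congr 2
  have hS : MeasurableSet {z : Plane × ℝ | exclusionRadius net i z.2 < ‖z.1‖} :=
    measurableSet_lt (by fun_prop) (by fun_prop)
  have hS' : ∀ p, MeasurableSet {y : Plane | exclusionRadius net i p < ‖y‖} := fun p =>
    measurableSet_lt (by fun_prop) (by fun_prop)
  set G : Plane × ℝ → ℝ≥0∞ := {z : Plane × ℝ | exclusionRadius net i z.2 < ‖z.1‖}.indicator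
    fun z => ENNReal.ofReal (1 - (1 / (1 + s * z.2 * ‖z.1‖ ^ (-net.α))) ^ T.card) with hG
  have hGm : Measurable G := (by fun_prop : Measurable _).indicator hS
  have h2 : ∀ p, ∫⁻ y in {y : Plane | exclusionRadius net i p < ‖y‖},
        ENNReal.ofReal (1 - (1 / (1 + s * p * ‖y‖ ^ (-net.α))) ^ T.card) = ∫⁻ y, G (y, p) := by
    intro p
    rw [← lintegral_indicator (hS' p)]
    rfl
  simp_rw [h2]
  -- The intensity integrates the location outermost, whereas the target integrates the power
  -- outermost; Tonelli reconciles them.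
  rw [lintegral_lintegral_swap (f := fun p y => G (y, p)) (by fun_prop)]
  refine lintegral_congr fun y => ?_
  rw [lintegral_prod _ (by fun_prop)]
  refine lintegral_congr_ae ?_
  filter_upwards [hpow] with p hp
  -- Being an interferer depends on location and power but not on gains, so the gain integral is
  -- either the full Laplace transform or zero.
  by_cases hy : exclusionRadius net i p < ‖y‖
  · have ht : 0 ≤ s * p * ‖y‖ ^ (-net.α) := by positivity
    have h3 : ∀ h : Gains (net.K i), f (y, p, h) =
        ∑ j ∈ T, ENNReal.ofReal (s * p * ‖y‖ ^ (-net.α) * h j) := by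
      intro h
      rw [hf, Set.indicator_of_mem (show (y, p, h) ∈ interfererSet net i from hy)]
      refine Finset.sum_congr rfl fun j _ => ?_
      rw [← ENNReal.ofReal_mul hs, rxPower]
      congr 1
      ring
    simp_rw [h3]
    have h4 : G (y, p) = _ := Set.indicator_of_mem
      (s := {z : Plane × ℝ | exclusionRadius net i z.2 < ‖z.1‖}) hy _
    rw [lintegral_sub (by fun_prop), lintegral_expNeg_sum_gainLaw T ht, h4,
      ENNReal.ofReal_sub _ (by positivity)]
    · simp
    · rw [lintegral_expNeg_sum_gainLaw T ht]; exact ENNReal.ofReal_ne_top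
    · exact Filter.Eventually.of_forall fun _ => expNeg_le_one _
  · have h3 : ∀ h : Gains (net.K i), f (y, p, h) = 0 := fun h =>
      Set.indicator_of_notMem (show (y, p, h) ∉ interfererSet net i from hy) _
    have h4 : G (y, p) = 0 := Set.indicator_of_notMem
      (s := {z : Plane × ℝ | exclusionRadius net i z.2 < ‖z.1‖}) hy _
    simp [h3, h4]

end Transmission

/-! ### Conditioned radial laws in the plane -/

lemma withDensity_radial_apply {κ : ℝ → ℝ} (hκ : Measurable κ) (hκ0 : ∀ r, 0 ≤ κ r) {B : Set ℝ}
    (hB : MeasurableSet B)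
    (hint : IntegrableOn (fun r => 2 * Real.pi * r * κ r) (Set.Ioi 0 ∩ B)) :
    (volume.withDensity fun x : Plane => ENNReal.ofReal (κ ‖x‖)) {x : Plane | ‖x‖ ∈ B} =
      ENNReal.ofReal (∫ r in Set.Ioi 0 ∩ B, 2 * Real.pi * r * κ r) := by
  have hms : MeasurableSet {x : Plane | ‖x‖ ∈ B} := measurable_norm hB
  have h := lintegral_fun_norm_plane (f := B.indicator fun r => ENNReal.ofReal (κ r))
    ((by fun_prop : Measurable _).indicator hB)
  rw [withDensity_apply _ hms, ← lintegral_indicator hms,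
    ofReal_integral_eq_lintegral_ofReal hint]
  · refine Eq.trans ?_ (h.trans ?_)
    · rfl
    · rw [← lintegral_const_mul _ (by
          exact (by fun_prop : Measurable fun r : ℝ => ENNReal.ofReal r).mul
            ((by fun_prop : Measurable _).indicator hB)),
        Set.inter_comm, ← setLIntegral_indicator hB]
      refine setLIntegral_congr_fun measurableSet_Ioi fun r hr => ?_
      have hr : 0 < r := hr
      by_cases hrB : r ∈ B
      · simp only [Set.indicator_of_mem hrB]
        rw [ENNReal.ofReal_mul (p := 2 * Real.pi * r) (by positivity),
          ENNReal.ofReal_mul (p := 2 * Real.pi) (by positivity), mul_assoc]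
      · simp [hrB]
  · refine (ae_restrict_iff' (measurableSet_Ioi.inter hB)).2
      (Filter.Eventually.of_forall fun r hr => ?_)
    have hr : 0 < r := hr.1
    have := hκ0 r
    positivity

/-- One formula for all conditioned laws of the model: uniform in an annulus (`κ = 1`), and the
contact law conditioned on a large or on a small distance. The constant `c` is the mass of the
conditioning event. -/
lemma lintegral_cond_radial {κ : ℝ → ℝ} (hκ : Measurable κ) (hκ0 : ∀ r, 0 ≤ κ r) {B : Set ℝ}
    (hB : MeasurableSet B) {c : ℝ} (hc : 0 < c)
    (hint : IntegrableOn (fun r => 2 * Real.pi * r * κ r) (Set.Ioi 0 ∩ B))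
    (hcint : ∫ r in Set.Ioi 0 ∩ B, 2 * Real.pi * r * κ r = c) {f : ℝ → ℝ≥0∞} (hf : Measurable f) :
    ∫⁻ x, f ‖x‖ ∂(cond (volume.withDensity fun x : Plane => ENNReal.ofReal (κ ‖x‖))
        {x : Plane | ‖x‖ ∈ B}) =
      ∫⁻ r in Set.Ioi 0 ∩ B, ENNReal.ofReal (2 * Real.pi * r * κ r / c) * f r := by
  have hms : MeasurableSet {x : Plane | ‖x‖ ∈ B} := measurable_norm hB
  have h := lintegral_fun_norm_plane (f := B.indicator fun r => ENNReal.ofReal (κ r) * f r)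
    ((by fun_prop : Measurable _).indicator hB)
  rw [ProbabilityTheory.cond, lintegral_smul_measure, smul_eq_mul,
    withDensity_radial_apply hκ hκ0 hB hint, hcint,
    setLIntegral_withDensity_eq_setLIntegral_mul _ (by fun_prop) (by fun_prop) hms,
    ← lintegral_indicator hms]
  refine Eq.trans (congrArg _ (Eq.trans ?_ h)) ?_
  · rfl
  · rw [← lintegral_const_mul _ (by
          exact (by fun_prop : Measurable fun r : ℝ => ENNReal.ofReal r).mul
            ((by fun_prop : Measurable _).indicator hB)),
        ← lintegral_const_mul' _ _ (by simp [hc]),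
        Set.inter_comm, ← setLIntegral_indicator hB]
    refine setLIntegral_congr_fun measurableSet_Ioi fun r hr => ?_
    have hr : 0 < r := hr
    have := hκ0 r
    by_cases hrB : r ∈ B
    · simp only [Set.indicator_of_mem hrB]
      rw [ENNReal.ofReal_div_of_pos hc, ENNReal.ofReal_mul (p := 2 * Real.pi * r) (by positivity),
        ENNReal.ofReal_mul (p := 2 * Real.pi) (by positivity), div_eq_mul_inv]
      ring
    · simp [hrB]

/-! ### Groups 1 and 2 -/

lemma Network.D₀_pos (net : Network) : 0 < net.D₀ := by
  have := net.δ₂_pos.trans net.δ₂_lt_δ₁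
  have := net.noiseDL_pos
  have := net.PDL_pos
  unfold Network.D₀
  positivity

lemma Network.D₁_pos (net : Network) : 0 < net.D₁ := by
  have := net.δ₂_pos
  have := net.noiseDL_pos
  have := net.PDL_pos
  unfold Network.D₁
  positivity

lemma Network.D₀_lt_D₁ (net : Network) : net.D₀ < net.D₁ := by
  have h1 := net.δ₂_pos
  have h2 := net.noiseDL_pos
  have h3 := net.PDL_pos
  have h4 := net.two_lt_α
  unfold Network.D₀ Network.D₁
  refine Real.rpow_lt_rpow_of_neg (by positivity) ?_ (by simp; linarith)
  have := net.δ₂_lt_δ₁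
  gcongr

lemma Network.D₂_pos (net : Network) : 0 < net.D₂ := by
  have := net.lamB_pos
  unfold Network.D₂
  positivity

lemma measurable_F (net : Network) (D : ℝ) (l : ℕ) : Measurable (F net D l) := by
  unfold F
  refine StronglyMeasurable.measurable ?_
  refine StronglyMeasurable.integral_prod_right
    (f := fun r y : ℝ => (1 - (1 / (1 + net.γth * r ^ net.α * y ^ (-net.α))) ^ l) * y) ?_
  refine Measurable.stronglyMeasurable ?_
  change Measurable fun q : ℝ × ℝ =>
    (1 - (1 / (1 + net.γth * q.1 ^ net.α * q.2 ^ (-net.α))) ^ l) * q.2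
  fun_prop

lemma measurable_linkFactor (net : Network) (i : Fin 3) (y D : ℝ) (l : ℕ) :
    Measurable (linkFactor net i y D l) := by
  have := measurable_F net D l
  unfold linkFactor
  fun_prop

lemma F_nonneg (net : Network) {D : ℝ} (hD : 0 < D) (l : ℕ) {r : ℝ} (hr : 0 < r) :
    0 ≤ F net D l r := by
  refine setIntegral_nonneg measurableSet_Ioi fun y hy => ?_
  have hy : 0 < y := hD.trans hy
  have := net.γth_pos
  have := (one_sub_pow_mem (u := net.γth * r ^ net.α * y ^ (-net.α)) (by positivity) l).1
  positivity

section Transmission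

variable {Ω : Type*} [MeasurableSpace Ω] {Pr : Measure Ω} [IsProbabilityMeasure Pr]
  {net : Network} {i : Fin 3} {y : ℝ} {X : Transmission Ω (net.K i)}

/-- The probability of reception in all repetitions of `T`, in the groups with fixed power. -/
lemma Transmission.HasModelLaw.measureReal_biInter_of_fixedPower
    (hX : X.HasModelLaw net i (y * net.lamA i) Pr) (hy : 0 ≤ y * net.lamA i)
    (hpow : powerLaw net i = Measure.dirac net.P) (htx : ∀ r, txPower net i r = net.P)
    {D : ℝ} (hD : 0 < D) (hex : ∀ p, exclusionRadius net i p = D)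
    {S : Set ℝ} (hS : MeasurableSet S) (hS0 : S ⊆ Set.Ioi 0) {pdf : ℝ → ℝ} (hpdf : Measurable pdf)
    (hpdf0 : ∀ r ∈ S, 0 ≤ pdf r)
    (hpos : ∀ f : ℝ → ℝ≥0∞, Measurable f →
      ∫⁻ p, f ‖p‖ ∂(Pr.map X.position) = ∫⁻ r in S, ENNReal.ofReal (pdf r) * f r)
    (T : Finset (Fin (net.K i))) :
    Pr.real (⋂ k ∈ T, X.receivedIn net i k) =
      ∫ r in S, linkFactor net i y D (4 * T.card) r * pdf r := by
  have hγ := net.γth_pos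
  have hP := net.P_pos
  have hσ := net.noise_pos
  -- Testing `hpos` on the indicator of zero shows that there is no atom at the BS, as `S` contains
  -- only positive radii.
  have h0 : Pr.map X.position {0} = 0 := by
    have h := hpos (Set.indicator {0} 1) (measurable_const.indicator (measurableSet_singleton 0))
    have h1 : ∀ p : Plane, (Set.indicator {0} 1 ‖p‖ : ℝ≥0∞) = Set.indicator {0} 1 p := by
      intro p
      by_cases hp : p = 0
      · simp [hp]
      · simp [hp]
    simp_rw [h1] at h
    rw [lintegral_indicator_one (measurableSet_singleton 0)] at h
    rw [h, setLIntegral_congr_fun (g := fun _ => 0) hS, lintegral_zero]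
    intro r hr
    have : r ≠ 0 := (hS0 hr).ne'
    simp [this]
  have hprob : IsProbabilityMeasure (powerLaw net i) := by rw [hpow]; infer_instance
  have hpow0 : ∀ᵐ p ∂(powerLaw net i), 0 ≤ p := by
    rw [hpow, ae_dirac_eq]; exact hP.le
  have hkey : Pr (⋂ k ∈ T, X.receivedIn net i k) =
      ∫⁻ p, ENNReal.ofReal (linkFactor net i y D (4 * T.card) ‖p‖) ∂(Pr.map X.position) := by
    rw [hX.measure_biInter_receivedIn h0]
    have hne : ∀ᵐ p ∂(Pr.map X.position), p ≠ 0 := measure_eq_zero_iff_ae_notMem.1 h0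
    refine lintegral_congr_ae ?_
    filter_upwards [hne] with p hp
    have hr : 0 < ‖p‖ := norm_pos_iff.2 hp
    have hF := F_nonneg net hD (4 * T.card) hr
    rw [hX.laplace_interference hpow0 _ (relThreshold_pos net i hr).le, hpow,
      lintegral_dirac, hex]
    have hs : relThreshold net i ‖p‖ = net.γth * ‖p‖ ^ net.α / net.P := by
      rw [relThreshold, htx, Real.rpow_neg hr.le]
      field_simp
    -- Device and interferers use the same power, so it cancels and leaves the coefficient appearing
    -- in `F`.
    have hsP : relThreshold net i ‖p‖ * net.P = net.γth * ‖p‖ ^ net.α := by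
      rw [hs]; field_simp
    rw [hsP, lintegral_pathLoss net.two_lt_α (by positivity) hD, Finset.card_product,
      Finset.card_univ, Fintype.card_fin, mul_comm T.card 4, ← ENNReal.ofReal_mul hy]
    change _ * expNeg (ENNReal.ofReal (_ * (2 * Real.pi * F net D (4 * T.card) ‖p‖))) = _
    rw [expNeg_ofReal (by positivity), ← ENNReal.ofReal_mul (Real.exp_nonneg _), linkFactor, hs]
    congr 3
    · congr 1; ring
    · congr 1; ring
  rw [measureReal_def, hkey, hpos (fun r => ENNReal.ofReal (linkFactor net i y D (4 * T.card) r))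
    (measurable_linkFactor net i y D _).ennreal_ofReal, integral_eq_lintegral_of_nonneg_ae]
  · congr 1
    refine setLIntegral_congr_fun hS fun r hr => ?_
    have := hpdf0 r hr
    rw [← ENNReal.ofReal_mul this, mul_comm]
  · refine (ae_restrict_iff' hS).2 (Filter.Eventually.of_forall fun r hr => ?_)
    have := hpdf0 r hr
    have : 0 ≤ linkFactor net i y D (4 * T.card) r := by unfold linkFactor; positivity
    simp only [Pi.zero_apply]
    positivity
  · exact ((measurable_linkFactor net i y D _).mul hpdf).aestronglyMeasurable

end Transmission

lemma lintegral_cond_annulus {a b : ℝ} (ha : 0 < a) (hab : a < b) {f : ℝ → ℝ≥0∞}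
    (hf : Measurable f) :
    ∫⁻ x, f ‖x‖ ∂(cond volume {x : Plane | a < ‖x‖ ∧ ‖x‖ ≤ b}) =
      ∫⁻ r in Set.Ioc a b, ENNReal.ofReal (annulusPDF a b r) * f r := by
  have hI : Set.Ioi 0 ∩ Set.Ioc a b = Set.Ioc a b :=
    Set.inter_eq_right.2 fun r hr => ha.trans hr.1
  have hc : 0 < Real.pi * (b ^ 2 - a ^ 2) := mul_pos Real.pi_pos (by nlinarith)
  have h := lintegral_cond_radial (κ := fun _ => 1) measurable_const (fun _ => zero_le_one)
    (B := Set.Ioc a b) measurableSet_Ioc hc (by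
      refine IntegrableOn.mono_set ?_ (hI.le.trans Set.Ioc_subset_Icc_self)
      exact ContinuousOn.integrableOn_Icc (by fun_prop)) (by
      rw [hI, ← intervalIntegral.integral_of_le hab.le]
      simp only [mul_one]
      rw [intervalIntegral.integral_const_mul, integral_id]
      ring) hf
  simp only [ENNReal.ofReal_one] at h
  rw [hI, show (fun _ : Plane => (1 : ℝ≥0∞)) = 1 from rfl, withDensity_one] at h
  refine h.trans (setLIntegral_congr_fun measurableSet_Ioc fun r hr => ?_)
  congr 2
  rw [annulusPDF]
  have : b ^ 2 - a ^ 2 ≠ 0 := by nlinarith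
  field_simp

lemma hasDerivAt_exp_neg_mul_sq (k r : ℝ) :
    HasDerivAt (fun r => -Real.exp (-(k * r ^ 2))) (2 * k * r * Real.exp (-(k * r ^ 2))) r := by
  have h := ((((hasDerivAt_pow 2 r).const_mul k).neg).exp).neg
  refine HasDerivAt.congr_deriv (f := fun r => -Real.exp (-(k * r ^ 2))) h ?_
  simp only [Pi.neg_apply, Nat.cast_ofNat, Nat.add_one_sub_one, pow_one]
  ring

lemma tendsto_exp_neg_mul_sq {k : ℝ} (hk : 0 < k) :
    Filter.Tendsto (fun r : ℝ => -Real.exp (-(k * r ^ 2))) Filter.atTop (nhds 0) := by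
  rw [← neg_zero]
  refine Filter.Tendsto.neg (Real.tendsto_exp_neg_atTop_nhds_zero.comp ?_)
  exact (Filter.tendsto_pow_atTop two_ne_zero).const_mul_atTop hk

/-- The event has mass `exp (-(π lam a ^ 2))`; dividing by it replaces `r ^ 2` by `r ^ 2 - a ^ 2` in
the exponent. -/
lemma lintegral_cond_contactLaw_gt {lam a : ℝ} (hlam : 0 < lam) (ha : 0 < a) {f : ℝ → ℝ≥0∞}
    (hf : Measurable f) :
    ∫⁻ x, f ‖x‖ ∂(cond (contactLaw lam) {x : Plane | a < ‖x‖}) =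
      ∫⁻ r in Set.Ioi a, ENNReal.ofReal
        (2 * Real.pi * lam * r * Real.exp (-(lam * Real.pi * (r ^ 2 - a ^ 2)))) * f r := by
  have hI : Set.Ioi 0 ∩ Set.Ioi a = Set.Ioi a :=
    Set.inter_eq_right.2 fun r hr => ha.trans hr
  have hk : 0 < Real.pi * lam := by positivity
  have hder : ∀ r : ℝ, 2 * Real.pi * r * (lam * Real.exp (-(Real.pi * lam * r ^ 2))) =
      2 * (Real.pi * lam) * r * Real.exp (-(Real.pi * lam * r ^ 2)) := fun r => by ring
  have h1 := integrableOn_Ioi_deriv_of_nonneg' (a := a)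
    (fun r _ => hasDerivAt_exp_neg_mul_sq (Real.pi * lam) r) (fun r hr => by
      have : 0 < r := ha.trans hr
      positivity) (tendsto_exp_neg_mul_sq hk)
  have h2 := integral_Ioi_of_hasDerivAt_of_tendsto' (a := a)
    (fun r _ => hasDerivAt_exp_neg_mul_sq (Real.pi * lam) r) h1 (tendsto_exp_neg_mul_sq hk)
  have h := lintegral_cond_radial (κ := fun r => lam * Real.exp (-(Real.pi * lam * r ^ 2)))
    (by fun_prop) (fun _ => by positivity) (B := Set.Ioi a) measurableSet_Ioi
    (Real.exp_pos (-(Real.pi * lam * a ^ 2))) (by simpa only [hI, hder] using h1) (by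
      simp only [hI, hder]
      rw [h2]; ring) hf
  rw [hI] at h
  refine h.trans (setLIntegral_congr_fun measurableSet_Ioi fun r hr => ?_)
  congr 2
  rw [div_eq_iff (Real.exp_pos _).ne', mul_assoc _ (Real.exp _) (Real.exp _), ← Real.exp_add]
  rw [show -(lam * Real.pi * (r ^ 2 - a ^ 2)) + -(Real.pi * lam * a ^ 2) =
    -(Real.pi * lam * r ^ 2) by ring]
  ring

/-! ### Group 0 -/

/-- Substitution `t = k * r ^ 2`. With `k = π lam` the right side is, up to the factor `k`, the
truncated second moment of the contact distance. -/
lemma lowerGamma_two (k R : ℝ) :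
    lowerGamma 2 (k * R ^ 2) =
      ∫ r in (0 : ℝ)..R, k * r ^ 2 * Real.exp (-(k * r ^ 2)) * (2 * k * r) := by
  have h := intervalIntegral.integral_comp_mul_deriv (a := 0) (b := R) (f := fun r => k * r ^ 2)
    (f' := fun r => 2 * k * r) (g := fun t => t * Real.exp (-t))
    (fun r _ => by
      refine ((hasDerivAt_pow 2 r).const_mul k).congr_deriv ?_
      simp only [Nat.cast_ofNat, Nat.add_one_sub_one, pow_one]
      ring) (by fun_prop) (by fun_prop)
  simp only [Function.comp_apply] at h
  rw [h, lowerGamma]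
  norm_num

lemma F₀_nonneg (net : Network) (l : ℕ) : 0 ≤ F₀ net l := by
  have := net.γth_pos
  refine setIntegral_nonneg measurableSet_Ioi fun y hy => ?_
  have hy : 0 < y := (Real.rpow_pos_of_pos this _).trans hy
  have := (one_sub_pow_mem (u := y ^ (-net.α)) (by positivity) l).1
  positivity

/-- When the exclusion radius equals the link distance, the substitution `y = γth ^ (1 / α) * r * u`
removes `r` from the integrand and sends the lower limit `r` to `γth ^ (-1 / α)`. Only the Jacobian
and the factor `y` remember `r`, through `r ^ 2`. -/
lemma F_self (net : Network) (l : ℕ) {r : ℝ} (hr : 0 < r) :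
    F net r l r = net.γth ^ (2 / net.α) * r ^ 2 * F₀ net l := by
  have hγ := net.γth_pos
  have hα : net.α ≠ 0 := by have := net.two_lt_α; linarith
  set b : ℝ := net.γth ^ (1 / net.α) * r with hb
  have hb0 : 0 < b := by positivity
  have hba : b * net.γth ^ (-1 / net.α) = r := by
    rw [hb, mul_right_comm, ← Real.rpow_add hγ, ← add_div]
    simp
  have hb2 : b ^ 2 = net.γth ^ (2 / net.α) * r ^ 2 := by
    rw [hb, mul_pow, ← Real.rpow_natCast (net.γth ^ _), ← Real.rpow_mul hγ.le]
    congr 2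
    push_cast
    ring
  have h := integral_comp_mul_left_Ioi
    (fun y => (1 - (1 / (1 + net.γth * r ^ net.α * y ^ (-net.α))) ^ l) * y)
    (net.γth ^ (-1 / net.α)) hb0
  rw [hba, smul_eq_mul] at h
  have h2 : ∀ u ∈ Set.Ioi (net.γth ^ (-1 / net.α)),
      (1 - (1 / (1 + net.γth * r ^ net.α * (b * u) ^ (-net.α))) ^ l) * (b * u) =
        b * ((1 - (1 / (1 + u ^ (-net.α))) ^ l) * u) := by
    intro u hu
    have hu : 0 < u := (Real.rpow_pos_of_pos hγ _).trans hu
    have h3 : net.γth * r ^ net.α * (b * u) ^ (-net.α) = u ^ (-net.α) := by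
      rw [Real.mul_rpow hb0.le hu.le, hb, Real.mul_rpow (by positivity) hr.le,
        ← Real.rpow_mul hγ.le, Real.rpow_neg hr.le, show 1 / net.α * -net.α = -1 by field_simp,
        Real.rpow_neg_one]
      field_simp
    rw [h3]
    ring
  rw [setIntegral_congr_fun measurableSet_Ioi h2, integral_const_mul] at h
  rw [← hb2, F, F₀, eq_comm, sq, mul_assoc, h]
  field_simp

/-- The exclusion radius inverts path-loss compensation: an interferer with own link distance `r` is
excluded exactly up to `r`, so `F_self` applies. -/
lemma lintegral_interference_of_powerControl (net : Network) (l : ℕ) {r : ℝ} (hr : 0 < r) :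
    ∫⁻ y in {y : Plane | exclusionRadius net 0 (txPower net 0 r) < ‖y‖},
      ENNReal.ofReal (1 - (1 / (1 + net.γth / net.ρ * txPower net 0 r * ‖y‖ ^ (-net.α))) ^ l) =
      ENNReal.ofReal (2 * Real.pi * (net.γth ^ (2 / net.α) * r ^ 2 * F₀ net l)) := by
  have hγ := net.γth_pos
  have hρ := net.ρ_pos
  have hα : net.α ≠ 0 := by have := net.two_lt_α; linarith
  have h1 : exclusionRadius net 0 (txPower net 0 r) = r := by
    change (net.ρ * r ^ net.α / net.ρ) ^ (1 / net.α) = r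
    rw [mul_div_cancel_left₀ _ hρ.ne', ← Real.rpow_mul hr.le, mul_one_div_cancel hα, Real.rpow_one]
  have h2 : net.γth / net.ρ * txPower net 0 r = net.γth * r ^ net.α := by
    change net.γth / net.ρ * (net.ρ * r ^ net.α) = _
    field_simp
  rw [h1, h2, lintegral_pathLoss net.two_lt_α (by positivity) hr, ← F_self net l hr, F]

/-- Maximal distance of a device of group 0 with power control to its BS. -/
def maxRadius (net : Network) : ℝ := (net.P / net.ρ) ^ (1 / net.α)

lemma maxRadius_pos (net : Network) : 0 < maxRadius net := by
  have := net.P_pos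
  have := net.ρ_pos
  unfold maxRadius
  positivity

lemma maxRadius_sq (net : Network) : maxRadius net ^ 2 = (net.P / net.ρ) ^ (2 / net.α) := by
  have := net.P_pos
  have := net.ρ_pos
  rw [maxRadius, ← Real.rpow_natCast, ← Real.rpow_mul (by positivity)]
  congr 1
  push_cast
  ring

lemma integral_contact_le (lam R : ℝ) :
    ∫ r in (0 : ℝ)..R, 2 * Real.pi * r * (lam * Real.exp (-(Real.pi * lam * r ^ 2))) =
      1 - Real.exp (-(Real.pi * lam * R ^ 2)) := by
  have hder : ∀ r : ℝ, 2 * Real.pi * r * (lam * Real.exp (-(Real.pi * lam * r ^ 2))) =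
      2 * (Real.pi * lam) * r * Real.exp (-(Real.pi * lam * r ^ 2)) := fun r => by ring
  simp_rw [hder]
  rw [intervalIntegral.integral_eq_sub_of_hasDerivAt
    (fun r _ => hasDerivAt_exp_neg_mul_sq (Real.pi * lam) r)
    (Continuous.intervalIntegrable (by fun_prop) _ _)]
  simp
  ring

lemma contact_le_pos {lam R : ℝ} (hlam : 0 < lam) (hR : 0 < R) :
    0 < 1 - Real.exp (-(Real.pi * lam * R ^ 2)) := by
  rw [sub_pos, Real.exp_lt_one_iff, neg_lt_zero]
  positivity

lemma integrableOn_contact_le (lam R : ℝ) :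
    IntegrableOn (fun r => 2 * Real.pi * r * (lam * Real.exp (-(Real.pi * lam * r ^ 2))))
      (Set.Ioi 0 ∩ Set.Iic R) := by
  rw [Set.Ioi_inter_Iic]
  exact (ContinuousOn.integrableOn_Icc (by fun_prop)).mono_set Set.Ioc_subset_Icc_self

lemma contactLaw_le {lam R : ℝ} (hlam : 0 < lam) (hR : 0 < R) :
    contactLaw lam {x : Plane | ‖x‖ ≤ R} =
      ENNReal.ofReal (1 - Real.exp (-(Real.pi * lam * R ^ 2))) := by
  have h := withDensity_radial_apply (κ := fun r => lam * Real.exp (-(Real.pi * lam * r ^ 2)))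
    (by fun_prop) (fun _ => by positivity) (B := Set.Iic R) measurableSet_Iic
    (integrableOn_contact_le lam R)
  rw [Set.Ioi_inter_Iic, ← intervalIntegral.integral_of_le hR.le, integral_contact_le] at h
  exact h

instance (net : Network) : IsProbabilityMeasure
    (cond (contactLaw net.lamB) {x : Plane | ‖x‖ ≤ (net.P / net.ρ) ^ (1 / net.α)}) := by
  have h := contactLaw_le net.lamB_pos (maxRadius_pos net)
  have hpos := contact_le_pos net.lamB_pos (maxRadius_pos net)
  refine cond_isProbabilityMeasure_of_finite ?_ ?_
  · change contactLaw net.lamB {x : Plane | ‖x‖ ≤ maxRadius net} ≠ 0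
    rw [h]; simpa using hpos
  · change contactLaw net.lamB {x : Plane | ‖x‖ ≤ maxRadius net} ≠ ∞
    rw [h]; simp

instance (net : Network) : IsProbabilityMeasure (powerLaw net 0) :=
  Measure.isProbabilityMeasure_map (by fun_prop)

/-- The mean of `C ‖x‖ ^ 2` for the displacement `x` of a device with power control from its BS. -/
lemma lintegral_sq_cond_contactLaw_le {lam R C : ℝ} (hlam : 0 < lam) (hR : 0 < R) (hC : 0 ≤ C)
    {f : ℝ → ℝ≥0∞} (hf : Measurable f) (hfC : ∀ r, 0 < r → f r = ENNReal.ofReal (C * r ^ 2)) :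
    ∫⁻ x, f ‖x‖ ∂(cond (contactLaw lam) {x : Plane | ‖x‖ ≤ R}) =
      ENNReal.ofReal (C * (lowerGamma 2 (Real.pi * lam * R ^ 2) /
        (Real.pi * lam * (1 - Real.exp (-(Real.pi * lam * R ^ 2)))))) := by
  have hc := contact_le_pos hlam hR
  have hk : 0 < Real.pi * lam := by positivity
  have h := lintegral_cond_radial (κ := fun r => lam * Real.exp (-(Real.pi * lam * r ^ 2)))
    (by fun_prop) (fun _ => by positivity) (B := Set.Iic R) measurableSet_Iic hc
    (integrableOn_contact_le lam R) (by
      rw [Set.Ioi_inter_Iic, ← intervalIntegral.integral_of_le hR.le, integral_contact_le]) hf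
  refine h.trans ?_
  rw [Set.Ioi_inter_Iic]
  set c := 1 - Real.exp (-(Real.pi * lam * R ^ 2))
  -- The constants are regrouped so that the remaining integrand is that of `lowerGamma_two`.
  have h2 : ∀ r ∈ Set.Ioc 0 R,
      ENNReal.ofReal (2 * Real.pi * r * (lam * Real.exp (-(Real.pi * lam * r ^ 2))) / c) * f r =
      ENNReal.ofReal (C / (Real.pi * lam * c) *
        (Real.pi * lam * r ^ 2 * Real.exp (-(Real.pi * lam * r ^ 2)) *
          (2 * (Real.pi * lam) * r))) := by
    intro r hr
    have hr0 : 0 < r := hr.1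
    rw [hfC r hr0, ← ENNReal.ofReal_mul (by positivity)]
    congr 1
    field_simp
  rw [setLIntegral_congr_fun measurableSet_Ioc h2, ← ofReal_integral_eq_lintegral_ofReal,
    ← intervalIntegral.integral_of_le hR.le, intervalIntegral.integral_const_mul, ← lowerGamma_two]
  · congr 1
    ring
  · exact (ContinuousOn.integrableOn_Icc (by fun_prop)).mono_set Set.Ioc_subset_Icc_self
  · refine (ae_restrict_iff' measurableSet_Ioc).2 (Filter.Eventually.of_forall fun r hr => ?_)
    have hr0 : 0 < r := hr.1
    simp only [Pi.zero_apply]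
    positivity

section Transmission

variable {Ω : Type*} [MeasurableSpace Ω] {Pr : Measure Ω} [IsProbabilityMeasure Pr]
  {net : Network} {y : ℝ}

/-- Power control makes the mean received power `ρ` at every distance, so the conditional
probability does not depend on the position. Randomness of the interferers' powers enters only
through the mean square of their link distances. -/
lemma Transmission.HasModelLaw.measureReal_biInter_zero {X : Transmission Ω (net.K 0)}
    (hX : X.HasModelLaw net 0 (y * net.lamA 0) Pr) (hy : 0 ≤ y * net.lamA 0)
    (T : Finset (Fin (net.K 0))) :
    Pr.real (⋂ k ∈ T, X.receivedIn net 0 k) = allReceived net 0 y (4 * T.card) := by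
  have hγ := net.γth_pos
  have hρ := net.ρ_pos
  have hlam := net.lamB_pos
  have hc := contact_le_pos hlam (maxRadius_pos net)
  have hF₀ := F₀_nonneg net (4 * T.card)
  have h0 : Pr.map X.position {0} = 0 := hX.position_law
  have := Measure.isProbabilityMeasure_map (μ := Pr) hX.measurable_position.aemeasurable
  have hpow0 : ∀ᵐ p ∂(powerLaw net 0), 0 ≤ p := by
    refine (ae_map_iff (by fun_prop) measurableSet_Ici).2 (Filter.Eventually.of_forall fun x => ?_)
    change 0 ≤ net.ρ * ‖x‖ ^ net.α
    positivity
  have hlow : 0 ≤ lowerGamma 2 (Real.pi * net.lamB * maxRadius net ^ 2) := by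
    have := maxRadius_pos net
    refine intervalIntegral.integral_nonneg (by positivity) fun u hu => ?_
    have := hu.1
    positivity
  have hlap : ∀ l : ℕ, ∫⁻ p, (∫⁻ y in {y : Plane | exclusionRadius net 0 p < ‖y‖},
      ENNReal.ofReal (1 - (1 / (1 + net.γth / net.ρ * p * ‖y‖ ^ (-net.α))) ^ l)) ∂(powerLaw net 0) =
      ENNReal.ofReal (2 * Real.pi * (net.γth ^ (2 / net.α) * F₀ net l) *
        (lowerGamma 2 (Real.pi * net.lamB * maxRadius net ^ 2) /
        (Real.pi * net.lamB * (1 - Real.exp (-(Real.pi * net.lamB * maxRadius net ^ 2)))))) := by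
    intro l
    have hS : MeasurableSet {z : ℝ × Plane | exclusionRadius net 0 z.1 < ‖z.2‖} :=
      measurableSet_lt (by fun_prop) (by fun_prop)
    have hS' : ∀ p, MeasurableSet {y : Plane | exclusionRadius net 0 p < ‖y‖} := fun p =>
      measurableSet_lt (by fun_prop) (by fun_prop)
    have hG : Measurable fun p => ∫⁻ y in {y : Plane | exclusionRadius net 0 p < ‖y‖},
        ENNReal.ofReal (1 - (1 / (1 + net.γth / net.ρ * p * ‖y‖ ^ (-net.α))) ^ l) := by
      simp_rw [← lintegral_indicator (hS' _)]
      exact Measurable.lintegral_prod_right' (f :=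
        {z : ℝ × Plane | exclusionRadius net 0 z.1 < ‖z.2‖}.indicator fun z : ℝ × Plane =>
          ENNReal.ofReal (1 - (1 / (1 + net.γth / net.ρ * z.1 * ‖z.2‖ ^ (-net.α))) ^ l))
        ((by fun_prop : Measurable _).indicator hS)
    have hF := F₀_nonneg net l
    rw [powerLaw, lintegral_map hG (by fun_prop)]
    refine lintegral_sq_cond_contactLaw_le hlam (maxRadius_pos net) (by positivity)
      (hG.comp (measurable_txPower net 0)) fun r hr => ?_
    rw [Function.comp_apply, lintegral_interference_of_powerControl net l hr]
    congr 1
    ring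
  have hkey : Pr (⋂ k ∈ T, X.receivedIn net 0 k) =
      ENNReal.ofReal (allReceived net 0 y (4 * T.card)) := by
    rw [hX.measure_biInter_receivedIn h0]
    have hne : ∀ᵐ p ∂(Pr.map X.position), p ≠ 0 := measure_eq_zero_iff_ae_notMem.1 h0
    rw [lintegral_congr_ae (g := fun _ => ENNReal.ofReal (allReceived net 0 y (4 * T.card)))]
    · simp
    filter_upwards [hne] with p hp
    have hr : 0 < ‖p‖ := norm_pos_iff.2 hp
    have hs : relThreshold net 0 ‖p‖ = net.γth / net.ρ := by
      change net.γth / (net.ρ * ‖p‖ ^ net.α * ‖p‖ ^ (-net.α)) = _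
      rw [Real.rpow_neg hr.le]
      field_simp
    rw [hs, hX.laplace_interference hpow0 _ (by positivity), hlap, Finset.card_product,
      Finset.card_univ, Fintype.card_fin, mul_comm T.card 4, ← ENNReal.ofReal_mul hy,
      expNeg_ofReal (by positivity), ← ENNReal.ofReal_mul (Real.exp_nonneg _), ← Real.exp_add]
    simp only [allReceived]
    rw [← maxRadius_sq]
    congr 2
    field_simp
    ring
  rw [measureReal_def, hkey, ENNReal.toReal_ofReal]
  exact Real.exp_nonneg _

/-! ### All groups -/

lemma Transmission.HasModelLaw.measureReal_biInter {i : Fin 3}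
    (hD : i = 2 → net.outer = OuterCase.fixedRadius → net.D₁ < net.D₂)
    {X : Transmission Ω (net.K i)}
    (hX : X.HasModelLaw net i (y * net.lamA i) Pr) (hy : 0 ≤ y * net.lamA i)
    (T : Finset (Fin (net.K i))) :
    Pr.real (⋂ k ∈ T, X.receivedIn net i k) = allReceived net i y (4 * T.card) := by
  have hD₀ := net.D₀_pos
  have hD₁ := net.D₁_pos
  have hD₂ := net.D₂_pos
  have hD₀₁ := net.D₀_lt_D₁
  have hann : ∀ a b : ℝ, a < b → 0 < a → ∀ r ∈ Set.Ioc a b, 0 ≤ annulusPDF a b r := by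
    intro a b hab ha r hr
    have h1 : 0 < r := ha.trans hr.1
    have h2 : 0 < b ^ 2 - a ^ 2 := by nlinarith
    unfold annulusPDF
    positivity
  have hannm : ∀ a b : ℝ, Measurable (annulusPDF a b) := by
    intro a b
    unfold annulusPDF
    fun_prop
  have hlaw := hX.position_law
  match i with
  | 0 => exact hX.measureReal_biInter_zero hy T
  | 1 =>
    simp only [IsPositionLaw] at hlaw
    rw [hX.measureReal_biInter_of_fixedPower hy rfl (fun _ => rfl) hD₁ (fun _ => rfl)
      measurableSet_Ioc (fun r hr => hD₀.trans hr.1) (hannm net.D₀ net.D₁) (hann _ _ hD₀₁ hD₀)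
      (fun f hf => by rw [hlaw, lintegral_cond_annulus hD₀ hD₀₁ hf]), allReceived,
      intervalIntegral.integral_of_le hD₀₁.le]
  | 2 =>
    cases ho : net.outer with
    | fixedRadius =>
      -- Without this inequality the annulus could be empty, and conditioning on it would not give a
      -- probability law.
      have hD₁₂ := hD rfl ho
      simp only [IsPositionLaw, ho] at hlaw
      rw [hX.measureReal_biInter_of_fixedPower hy rfl (fun _ => rfl) hD₂
        (fun _ => by simp only [exclusionRadius, ho])
        measurableSet_Ioc (fun r hr => hD₁.trans hr.1) (hannm net.D₁ net.D₂) (hann _ _ hD₁₂ hD₁)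
        (fun f hf => by rw [hlaw, lintegral_cond_annulus hD₁ hD₁₂ hf])]
      simp only [allReceived, ho]
      rw [intervalIntegral.integral_of_le hD₁₂.le]
    | voronoiCell =>
      simp only [IsPositionLaw, ho] at hlaw
      have hlam := net.lamB_pos
      rw [hX.measureReal_biInter_of_fixedPower hy rfl (fun _ => rfl) hD₁
        (fun _ => by simp only [exclusionRadius, ho])
        measurableSet_Ioi (fun r hr => hD₁.trans hr) (pdf := voronoiPDF net)
        (by unfold voronoiPDF; fun_prop) (fun r hr => by
          have : 0 < r := hD₁.trans hr
          unfold voronoiPDF; positivity)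
        (fun f hf => by rw [hlaw, lintegral_cond_contactLaw_gt hlam hD₁ hf]; rfl)]
      simp only [allReceived, ho]

/-- The preamble transmission success probability. -/
theorem Transmission.HasModelLaw.measureReal_received {i : Fin 3}
    (hD : i = 2 → net.outer = OuterCase.fixedRadius → net.D₁ < net.D₂)
    {X : Transmission Ω (net.K i)}
    (hX : X.HasModelLaw net i (y * net.lamA i) Pr) (hy : 0 ≤ y * net.lamA i) :
    Pr.real (X.received net i) = bigTheta net i y := by
  have h1 : X.received net i = ⋃ k ∈ (Finset.univ : Finset (Fin (net.K i))),
      X.receivedIn net i k := by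
    ext ω
    simp [Transmission.received, Transmission.receivedIn]
  rw [h1, measureReal_biUnion_eq_sum_powerset (fun k _ => hX.measurableSet_receivedIn k)]
  simp_rw [hX.measureReal_biInter hD hy]
  rw [Finset.sum_filter]
  -- Inclusion–exclusion terms depend on `T` only through its size. The value 0 at size 0 lets the
  -- sum run over the whole powerset, where grouping by size yields the binomial coefficients.
  have h2 : ∀ T : Finset (Fin (net.K i)),
      (if T.Nonempty then (-1 : ℝ) ^ (T.card + 1) * allReceived net i y (4 * T.card) else 0) =
      (fun k : ℕ => if k = 0 then 0 else (-1 : ℝ) ^ (k + 1) * allReceived net i y (4 * k))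
        T.card := by
    intro T
    rcases T.eq_empty_or_nonempty with rfl | hT
    · simp
    · simp [hT, hT.ne_empty]
  simp_rw [h2]
  rw [Finset.sum_powerset_apply_card (fun k : ℕ =>
    if k = 0 then 0 else (-1 : ℝ) ^ (k + 1) * allReceived net i y (4 * k)),
    Finset.card_univ, Fintype.card_fin, bigTheta, eq_comm]
  refine Finset.sum_subset_zero_on_sdiff (fun k hk => ?_) (fun k hk => ?_) (fun k hk => ?_)
  · simp only [Finset.mem_Icc, Finset.mem_range] at hk ⊢
    omega
  · have : k = 0 := by
      simp only [Finset.mem_sdiff, Finset.mem_Icc, Finset.mem_range] at hk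
      omega
    simp [this]
  · have : k ≠ 0 := by
      simp only [Finset.mem_Icc] at hk
      omega
    rw [if_neg this, nsmul_eq_mul]
    ring

end Transmission

/-! ### The number of intra-group interferers -/

lemma cellConst_pos : 0 < cellConst := by unfold cellConst; norm_num

/-- A Poisson law mixed over a gamma-distributed parameter. -/
lemma toReal_lintegral_poissonMeasure_gammaMeasure {x a r : ℝ} (hx : 0 ≤ x) (ha : 0 < a)
    (hr : 0 < r) (n : ℕ) :
    (∫⁻ s, poissonMeasure (x * s).toNNReal {n} ∂(gammaMeasure a r)).toReal =
      r ^ a / Real.Gamma a * (x ^ n / n.factorial) *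
        ((1 / (r + x)) ^ (n + a) * Real.Gamma (n + a)) := by
  have hm : Measurable (gammaPDF a r) := (measurable_gammaPDFReal a r).ennreal_ofReal
  have hΓ := Real.Gamma_pos_of_pos ha
  -- The Poisson weight times the gamma density is again a gamma kernel, of shape `n + a` and rate
  -- `r + x`.
  have h1 : ∫⁻ s, poissonMeasure (x * s).toNNReal {n} ∂(gammaMeasure a r) =
      ∫⁻ s in Set.Ioi 0, ENNReal.ofReal (r ^ a / Real.Gamma a * (x ^ n / n.factorial) *
        (s ^ ((n + a) - 1) * Real.exp (-((r + x) * s)))) := by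
    rw [gammaMeasure, lintegral_withDensity_eq_lintegral_mul_non_measurable _ hm
      (Filter.Eventually.of_forall fun x => by simp [gammaPDF]),
      ← lintegral_indicator measurableSet_Ioi]
    refine lintegral_congr_ae ?_
    filter_upwards [Measure.ae_ne volume (0 : ℝ)] with s hs
    rcases lt_or_gt_of_ne hs with h | h
    · simp [gammaPDF_of_neg h, h.le]
    · rw [Set.indicator_of_mem (show s ∈ Set.Ioi 0 from h), Pi.mul_apply,
        gammaPDF_of_nonneg h.le, poissonMeasure_singleton, ← ENNReal.ofReal_mul (by positivity),
        Real.coe_toNNReal _ (by positivity), mul_pow, add_sub_assoc, Real.rpow_add h,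
        Real.rpow_natCast, add_mul, neg_add, Real.exp_add]
      congr 1
      ring
  rw [h1, ← integral_eq_lintegral_of_nonneg_ae, integral_const_mul,
    Real.integral_rpow_mul_exp_neg_mul_Ioi (by positivity) (by positivity)]
  · refine (ae_restrict_iff' measurableSet_Ioi).2 (Filter.Eventually.of_forall fun s hs => ?_)
    have hs : 0 < s := hs
    simp only [Pi.zero_apply]
    positivity
  · exact Measurable.aestronglyMeasurable (by fun_prop)

/-- Both the gamma rate and the Poisson parameter scale with `lamB`, so its powers cancel and only
the ratio `u` of densities remains. -/
lemma toReal_lintegral_poissonMeasure_cell (net : Network) (i : Fin 3) {y : ℝ}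
    (hy : 0 ≤ y * net.lamA i) (n : ℕ) :
    (∫⁻ s, poissonMeasure (y * net.lamA i * s).toNNReal {n}
      ∂(gammaMeasure (cellConst + 1) (cellConst * net.lamB))).toReal = bigO net i y n := by
  have hc := cellConst_pos
  have hlam := net.lamB_pos
  rw [toReal_lintegral_poissonMeasure_gammaMeasure hy (by positivity) (by positivity), bigO,
    Real.Gamma_nat_eq_factorial]
  set u := y * net.lamA i / net.lamB with hu
  have hu0 : 0 ≤ u := by positivity
  have hyu : y * net.lamA i = net.lamB * u := by rw [hu]; field_simp
  have h1 : cellConst * net.lamB + y * net.lamA i = net.lamB * (u + cellConst) := by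
    rw [hyu]; ring
  have hΓ := Real.Gamma_pos_of_pos (show 0 < cellConst + 1 by positivity)
  rw [h1, hyu, Real.mul_rpow hc.le hlam.le, mul_pow, Real.div_rpow zero_le_one (by positivity),
    Real.one_rpow, Real.mul_rpow hlam.le (by positivity), Real.rpow_add (y := (n : ℝ)) hlam,
    Real.rpow_natCast, ← add_assoc]
  have h2 : (u + cellConst) ^ (n + cellConst + 1) ≠ 0 := by positivity
  have h3 : net.lamB ^ (cellConst + 1) ≠ 0 := by positivity
  field_simp

/-! ### Success probability -/

section History

variable {Ω : Type*} [MeasurableSpace Ω] {Pr : Measure Ω} [IsProbabilityMeasure Pr]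

/-- The level sets of `N` partition the space, and boundedness of `φ` gives the integrability needed
for countable additivity. -/
lemma hasSum_integral_comp_nat {N : Ω → ℕ} (hN : Measurable N) {φ : ℕ → ℝ} {C : ℝ}
    (hφ : ∀ n, ‖φ n‖ ≤ C) :
    HasSum (fun n => Pr.real {ω | N ω = n} * φ n) (∫ ω, φ (N ω) ∂Pr) := by
  have hms : ∀ n, MeasurableSet {ω | N ω = n} := fun n => hN (measurableSet_singleton n)
  have hint : Integrable (fun ω => φ (N ω)) Pr :=
    Integrable.of_bound ((measurable_of_countable φ).comp hN).aestronglyMeasurable C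
      (Filter.Eventually.of_forall fun ω => hφ _)
  have h := hasSum_integral_iUnion (f := fun ω => φ (N ω)) (μ := Pr) hms
    (fun m n hmn => Set.disjoint_left.2 fun ω h1 h2 => hmn (h1.symm.trans h2)) hint.integrableOn
  have hU : ⋃ n, {ω | N ω = n} = Set.univ := by
    ext ω; simp
  rw [hU, setIntegral_univ] at h
  have h2 : ∀ n, ∫ ω in {ω | N ω = n}, φ (N ω) ∂Pr = Pr.real {ω | N ω = n} * φ n := fun n => by
    rw [setIntegral_congr_fun (g := fun _ => φ n) (hms n) (fun ω hω => congrArg φ hω),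
      setIntegral_const, smul_eq_mul]
  simpa only [h2] using h

variable {net : Network} {i : Fin 3} {H : History Ω (net.K i)}

lemma History.preamble_mem (t m : ℕ) : H.preamble net i Pr t m ∈ Set.Icc (0 : ℝ) 1 :=
  ⟨measureReal_nonneg, measureReal_le_one⟩

lemma History.success_mem (t : ℕ) : H.success net i Pr t ∈ Set.Icc (0 : ℝ) 1 := by
  have h : ∀ ω, 0 ≤ H.preamble net i Pr t 0 *
      ∏ m ∈ Finset.Icc 1 (H.intra t ω), (1 - H.preamble net i Pr t m) ∧
      H.preamble net i Pr t 0 *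
      ∏ m ∈ Finset.Icc 1 (H.intra t ω), (1 - H.preamble net i Pr t m) ≤ 1 := by
    intro ω
    have h1 : ∀ m, 0 ≤ 1 - H.preamble net i Pr t m := fun m =>
      sub_nonneg.2 (H.preamble_mem t m).2
    have h2 : ∀ m, 1 - H.preamble net i Pr t m ≤ 1 := fun m =>
      sub_le_self _ (H.preamble_mem t m).1
    have h3 := H.preamble_mem (Pr := Pr) (net := net) (i := i) t 0
    have h4 : 0 ≤ ∏ m ∈ Finset.Icc 1 (H.intra t ω), (1 - H.preamble net i Pr t m) :=
      Finset.prod_nonneg fun m _ => h1 m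
    have h5 : ∏ m ∈ Finset.Icc 1 (H.intra t ω), (1 - H.preamble net i Pr t m) ≤ 1 :=
      Finset.prod_le_one (fun m _ => h1 m) fun m _ => h2 m
    exact ⟨mul_nonneg h3.1 h4, mul_le_one₀ h3.2 h4 h5⟩
  refine ⟨integral_nonneg fun ω => (h ω).1, ?_⟩
  have := integral_mono_of_nonneg (μ := Pr) (Filter.Eventually.of_forall fun ω => (h ω).1)
    (integrable_const (1 : ℝ)) (Filter.Eventually.of_forall fun ω => (h ω).2)
  simpa [History.success] using this

lemma History.hasSum_success {t : ℕ} (hmeas : Measurable (H.intra t)) {θ : ℝ}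
    (hθ : ∀ m, H.preamble net i Pr t m = θ) {O : ℕ → ℝ}
    (hO : ∀ n, Pr.real {ω | H.intra t ω = n} = O n) :
    HasSum (fun n => O n * θ * (1 - θ) ^ n) (H.success net i Pr t) := by
  have h0 := H.preamble_mem (Pr := Pr) (net := net) (i := i) t 0
  rw [hθ] at h0
  have h := hasSum_integral_comp_nat (Pr := Pr) hmeas (φ := fun n => θ * (1 - θ) ^ n) (C := 1)
    (fun n => by
      have h1 : 0 ≤ 1 - θ := sub_nonneg.2 h0.2
      have h2 := pow_le_one₀ (n := n) h1 (sub_le_self _ h0.1)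
      rw [Real.norm_eq_abs, abs_of_nonneg (mul_nonneg h0.1 (pow_nonneg h1 n))]
      exact mul_le_one₀ h0.2 (pow_nonneg h1 n) h2)
  simp only [hO, ← mul_assoc] at h
  simpa [History.success, hθ] using h

/-! ### The queue -/

/-- By independence the buffer is empty with the product of two Poisson probabilities of zero. The
sign condition `hμ` is essential, because `cum_law` truncates a negative mean to 0. -/
lemma History.IsModel.nonEmpty_eq {sch : Scheme} (hH : H.IsModel net i sch Pr) {t : ℕ}
    (ht : 1 ≤ t) (hμ : 0 ≤ H.μCum net i sch Pr t) :
    H.nonEmpty Pr t = 1 - Real.exp (-net.μNew t - H.μCum net i sch Pr t) := by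
  have hnew : 0 ≤ net.μNew t := by
    have := net.τr_pos
    have := net.τg_pos
    have := net.ε_pos t
    unfold Network.μNew
    positivity
  have hN := hH.measurable_new t ht
  have hC := hH.measurable_cum t ht
  have h0 : MeasurableSet ({0} : Set ℕ) := measurableSet_singleton 0
  have hset : {ω | 0 < H.newPackets t ω + H.cumPackets t ω} =
      (H.newPackets t ⁻¹' {0} ∩ H.cumPackets t ⁻¹' {0})ᶜ := by
    ext ω
    simp only [Set.mem_ofPred_eq, Set.mem_compl_iff, Set.mem_inter_iff, Set.mem_preimage,
      Set.mem_singleton_iff]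
    omega
  rw [History.nonEmpty, hset, probReal_compl_eq_one_sub ((hN h0).inter (hC h0)), measureReal_def,
    (hH.indep_packets t ht).measure_inter_preimage_eq_mul _ _ h0 h0, ← Measure.map_apply hN h0,
    ← Measure.map_apply hC h0, hH.new_law t ht, hH.cum_law t ht, poissonMeasure_singleton,
    poissonMeasure_singleton, ENNReal.toReal_mul, ENNReal.toReal_ofReal (by positivity),
    ENNReal.toReal_ofReal (by positivity), Real.coe_toNNReal _ hnew, Real.coe_toNNReal _ hμ,
    sub_eq_add_neg (-net.μNew t), Real.exp_add]
  simp

end History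

/-! ### Back-off -/

lemma backoffProb_eq_range (e : ℝ) (T : ℕ) (A P : ℕ → ℝ) (t : ℕ) :
    backoffProb e T A P t = 1 - (∑ s ∈ Finset.range (min (t - 1) T),
      (1 - e * P (t - (s + 1))) * A (t - (s + 1)) * backoffProb e T A P (t - (s + 1))) / A t := by
  rw [backoffProb, Fin.sum_univ_eq_sum_range (fun s =>
    (1 - e * P (t - (s + 1))) * A (t - (s + 1)) * backoffProb e T A P (t - (s + 1)))]

lemma backoffProb_eq (e : ℝ) (T : ℕ) (A P : ℕ → ℝ) (t : ℕ) :
    backoffProb e T A P t = 1 - (∑ s ∈ Finset.Icc 1 (min (t - 1) T),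
      (1 - e * P (t - s)) * A (t - s) * backoffProb e T A P (t - s)) / A t := by
  rw [backoffProb_eq_range, Finset.range_eq_Ico, Finset.sum_Ico_add' (fun s =>
    (1 - e * P (t - s)) * A (t - s) * backoffProb e T A P (t - s))]
  rfl

/-- The map `M ↦ 1 - exp (-M)` is 1-Lipschitz on `[0, ∞)`: removing `d` packets on average lowers
the non-empty probability by at most `d`. -/
lemma one_sub_exp_neg_sub_le {M d : ℝ} (hd0 : 0 ≤ d) (hd : d ≤ M) :
    1 - Real.exp (-M) - d ≤ 1 - Real.exp (-(M - d)) := by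
  have h1 : Real.exp (-M) = Real.exp (-(M - d)) * Real.exp (-d) := by
    rw [← Real.exp_add]; congr 1; ring
  have h2 : Real.exp (-(M - d)) ≤ 1 := Real.exp_le_one_iff.2 (by linarith)
  have h3 := Real.add_one_le_exp (-d)
  have h4 := Real.exp_pos (-(M - d))
  nlinarith [mul_le_mul_of_nonneg_left h3 h4.le, mul_le_mul_of_nonneg_right h2 hd0]

/-- Mean departures `q * A` cannot exceed `A = 1 - exp (-M) ≤ M`. -/
lemma queue_nonneg {M A q : ℝ} (hM : 0 ≤ M) (hA : A = 1 - Real.exp (-M)) (hq1 : q ≤ 1) :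
    0 ≤ M - q * A := by
  have h1 := Real.add_one_le_exp (-M)
  have h2 : 0 ≤ A := by
    rw [hA, sub_nonneg, Real.exp_le_one_iff]; linarith
  nlinarith

/-- Along the iteration with back-off, queues and attempt probabilities stay nonnegative. -/
lemma backoff_nonneg {e : ℝ} (T : ℕ) {A P μ ν : ℕ → ℝ} (he : e ∈ Set.Icc (0 : ℝ) 1)
    (hP : ∀ t, P t ∈ Set.Icc (0 : ℝ) 1) (hν : ∀ t, 0 < ν t) (hμ1 : μ 1 = 0)
    (hμ : ∀ t, 1 ≤ t → μ (t + 1) = ν t + μ t - e * P t * backoffProb e T A P t * A t)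
    (hA : ∀ t, 1 ≤ t → 0 ≤ μ t → A t = 1 - Real.exp (-ν t - μ t)) (t : ℕ) (ht : 1 ≤ t) :
    0 ≤ μ t ∧ ∀ s, 1 ≤ s → s ≤ t → 0 ≤ A s * backoffProb e T A P s := by
  set R := backoffProb e T A P with hR
  have hApos : ∀ t, 1 ≤ t → 0 ≤ μ t → 0 < A t := by
    intro t ht hμt
    rw [hA t ht hμt, sub_pos, Real.exp_lt_one_iff]
    linarith [hν t]
  have hq : ∀ t, e * P t ∈ Set.Icc (0 : ℝ) 1 := fun t =>
    ⟨mul_nonneg he.1 (hP t).1, mul_le_one₀ he.2 (hP t).1 (hP t).2⟩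
  -- Multiplying by `A t > 0` clears the division: the attempt probability `A t * R t` is `A t`
  -- minus the failed attempts in the window.
  have hu : ∀ t, 1 ≤ t → 0 ≤ μ t → A t * R t = A t - ∑ s ∈ Finset.range (min (t - 1) T),
      (1 - e * P (t - (s + 1))) * (A (t - (s + 1)) * R (t - (s + 1))) := by
    intro t ht hμt
    have := (hApos t ht hμt).ne'
    rw [hR, backoffProb_eq_range, ← hR, mul_sub, mul_one, mul_div_cancel₀ _ this]
    simp_rw [mul_assoc]
  induction t, ht using Nat.le_induction with
  | base =>
    refine ⟨hμ1.ge, fun s h1 h2 => ?_⟩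
    obtain rfl : s = 1 := le_antisymm h2 h1
    rw [hu 1 le_rfl hμ1.ge]
    simpa using (hApos 1 le_rfl hμ1.ge).le
  | succ t ht ih =>
    obtain ⟨hμt, hus⟩ := ih
    have hAt := hApos t ht hμt
    have hS0 : 0 ≤ ∑ s ∈ Finset.range (min (t - 1) T),
        (1 - e * P (t - (s + 1))) * (A (t - (s + 1)) * R (t - (s + 1))) := by
      refine Finset.sum_nonneg fun s hs => mul_nonneg (sub_nonneg.2 (hq _).2) (hus _ ?_ ?_)
      · have := Finset.mem_range.1 hs; omega
      · omega
    have hut := hus t ht le_rfl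
    have hutA : A t * R t ≤ A t := by rw [hu t ht hμt]; linarith
    have hM : A t = 1 - Real.exp (-(ν t + μ t)) := by rw [hA t ht hμt]; congr 2; ring
    have hAM : A t ≤ ν t + μ t := by
      have := Real.add_one_le_exp (-(ν t + μ t)); linarith
    have hd0 : 0 ≤ e * P t * (A t * R t) := mul_nonneg (hq t).1 hut
    have hdA : e * P t * (A t * R t) ≤ A t := by nlinarith [(hq t).2]
    have hstep : μ (t + 1) = ν t + μ t - e * P t * (A t * R t) := by rw [hμ t ht]; ring
    have hμs : 0 ≤ μ (t + 1) := by rw [hstep]; linarith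
    have hAs := hApos (t + 1) (by omega) hμs
    refine ⟨hμs, fun s h1 h2 => ?_⟩
    rcases Nat.lt_or_ge t s with h | h
    swap
    · exact hus s h1 h
    obtain rfl : s = t + 1 := by omega
    rw [hu (t + 1) h1 hμs, sub_nonneg]
    rcases Nat.eq_zero_or_pos T with hT | hT
    · simpa [hT] using hAs.le
    · obtain ⟨m, hm⟩ : ∃ m, min (t + 1 - 1) T = m + 1 := ⟨min (t + 1 - 1) T - 1, by omega⟩
      rw [hm, Finset.sum_range_succ']
      -- Apart from its newest slot `t`, the window of slot `t + 1` lies inside the window of slot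
      -- `t`, and all terms are nonnegative.
      have h3 : ∑ s ∈ Finset.range m, (1 - e * P (t + 1 - (s + 1 + 1))) *
          (A (t + 1 - (s + 1 + 1)) * R (t + 1 - (s + 1 + 1))) ≤
          ∑ s ∈ Finset.range (min (t - 1) T),
            (1 - e * P (t - (s + 1))) * (A (t - (s + 1)) * R (t - (s + 1))) := by
        simp only [Nat.add_sub_add_right]
        refine Finset.sum_le_sum_of_subset_of_nonneg (Finset.range_subset_range.2 (by omega))
          fun s hs _ => mul_nonneg (sub_nonneg.2 (hq _).2) (hus _ ?_ ?_)
        · have := Finset.mem_range.1 hs; omega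
        · omega
      -- With `d = e * P t * (A t * R t)`, the failures in the new window total at most `(A t * R t
      -- - d) + (A t - A t * R t) = A t - d`. The Lipschitz bound, together with new arrivals, gives
      -- `A t - d ≤ A (t + 1)`.
      have h4 := one_sub_exp_neg_sub_le (M := ν t + μ t) (d := e * P t * (A t * R t))
        hd0 (by linarith)
      have h5 : 1 - Real.exp (-(ν t + μ t - e * P t * (A t * R t))) ≤ A (t + 1) := by
        rw [hA (t + 1) h1 hμs, hstep]
        have := Real.exp_le_exp.2 (show -ν (t + 1) - (ν t + μ t - e * P t * (A t * R t)) ≤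
          -(ν t + μ t - e * P t * (A t * R t)) by linarith [hν (t + 1)])
        linarith
      have h6 := hu t ht hμt
      rw [← hM] at h4
      simp only [zero_add, Nat.add_sub_cancel]
      linarith

/-! ### Nonnegativity along the iteration -/

lemma Network.g_mem (net : Network) (i : Fin 3)
    (hD : i = 2 → net.outer = OuterCase.fixedRadius → net.D₁ < net.D₂) :
    net.g i ∈ Set.Icc (0 : ℝ) 1 := by
  have hlam := net.lamB_pos
  have hD₁ := net.D₁_pos
  have hD₀ := net.D₀_pos
  have h0 : ∀ D : ℝ, 0 < Real.exp (-(net.lamB * Real.pi * D ^ 2)) := fun D => Real.exp_pos _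
  have h1 : ∀ D : ℝ, Real.exp (-(net.lamB * Real.pi * D ^ 2)) ≤ 1 := fun D =>
    Real.exp_le_one_iff.2 (neg_nonpos.2 (by positivity))
  have hmono : ∀ a b : ℝ, 0 < a → a < b →
      Real.exp (-(net.lamB * Real.pi * b ^ 2)) ≤ Real.exp (-(net.lamB * Real.pi * a ^ 2)) := by
    intro a b ha hab
    gcongr
  match i with
  | 0 => exact ⟨sub_nonneg.2 (h1 _), sub_le_self _ (h0 _).le⟩
  | 1 => exact ⟨sub_nonneg.2 (hmono _ _ hD₀ net.D₀_lt_D₁),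
      (sub_le_self _ (h0 _).le).trans (h1 _)⟩
  | 2 =>
    cases ho : net.outer with
    | fixedRadius =>
      simp only [Network.g, ho]
      exact ⟨sub_nonneg.2 (hmono _ _ hD₁ (hD rfl ho)), (sub_le_self _ (h0 _).le).trans (h1 _)⟩
    | voronoiCell =>
      simp only [Network.g, ho]
      exact ⟨(h0 _).le, h1 _⟩

lemma Network.μNew_pos (net : Network) (t : ℕ) : 0 < net.μNew t := by
  have := net.τr_pos
  have := net.τg_pos
  have := net.ε_pos t
  unfold Network.μNew
  positivity

lemma passProb_mem (net : Network) (sch : Scheme) : passProb net sch ∈ Set.Icc (0 : ℝ) 1 := by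
  cases sch
  case acbbo => exact net.Q_mem
  all_goals exact ⟨zero_le_one, le_rfl⟩

lemma volume_restrict_Icc_lt {Q : ℝ} (hQ : Q ∈ Set.Icc (0 : ℝ) 1) :
    (volume.restrict (Set.Icc (0 : ℝ) 1)).real {q | q < Q} = Q := by
  have h : {q : ℝ | q < Q} ∩ Set.Icc 0 1 = Set.Ico 0 Q := by
    ext q
    simp only [Set.mem_inter_iff, Set.mem_ofPred_eq, Set.mem_Icc, Set.mem_Ico]
    exact ⟨fun h => ⟨h.2.1, h.1⟩, fun h => ⟨h.2, h.1, h.2.le.trans hQ.2⟩⟩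
  rw [measureReal_restrict_apply (show MeasurableSet {q : ℝ | q < Q} from measurableSet_Iio), h,
    Real.volume_real_Ico_of_le hQ.1, sub_zero]

section History

variable {Ω : Type*} [MeasurableSpace Ω] {Pr : Measure Ω}
  {net : Network} {i : Fin 3} {H : History Ω (net.K i)} {sch : Scheme}

lemma History.μCum_succ {t : ℕ} (ht : 1 ≤ t) :
    H.μCum net i sch Pr (t + 1) = net.μNew t + H.μCum net i sch Pr t
      - net.g i * passProb net sch * H.success net i Pr t * H.nonRestrict net i sch Pr t *
        H.nonEmpty Pr t := by
  obtain ⟨k, rfl⟩ := Nat.exists_eq_add_of_le' ht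
  rw [History.μCum]

variable [IsProbabilityMeasure Pr]

/-- When the non-restrict probability is a genuine probability, the mean queue length stays
nonnegative. -/
lemma History.IsModel.μCum_nonneg_of_nonRestrict_mem (hH : H.IsModel net i sch Pr)
    (hg : net.g i ∈ Set.Icc (0 : ℝ) 1)
    (hR : ∀ t, H.nonRestrict net i sch Pr t ∈ Set.Icc (0 : ℝ) 1) (t : ℕ) (ht : 1 ≤ t) :
    0 ≤ H.μCum net i sch Pr t := by
  induction t, ht using Nat.le_induction with
  | base => rw [History.μCum]
  | succ t ht ih =>
    have hp := passProb_mem net sch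
    have hP := H.success_mem (Pr := Pr) (net := net) (i := i) t
    have h1 := mul_le_one₀ hg.2 hp.1 hp.2
    have h2 := mul_le_one₀ h1 hP.1 hP.2
    have h3 := mul_le_one₀ h2 (hR t).1 (hR t).2
    rw [History.μCum_succ ht]
    refine queue_nonneg (add_nonneg (net.μNew_pos t).le ih) ?_ h3
    rw [hH.nonEmpty_eq ht ih]
    congr 2
    ring

/-- These signs undo the truncations in the model. For baseline and ACB the non-restrict probability
is a constant in `[0, 1]`; for the back-off schemes its sign must be proved jointly with that of the
queue. -/
lemma History.IsModel.nonneg (hH : H.IsModel net i sch Pr) (hg : net.g i ∈ Set.Icc (0 : ℝ) 1)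
    {t : ℕ} (ht : 1 ≤ t) :
    0 ≤ H.μCum net i sch Pr t ∧ 0 ≤ H.nonEmpty Pr t * H.nonRestrict net i sch Pr t := by
  have hA : 0 ≤ H.nonEmpty Pr t := measureReal_nonneg
  have hp := passProb_mem net sch
  have hμ : ∀ t, 1 ≤ t → H.μCum net i sch Pr (t + 1) = net.μNew t + H.μCum net i sch Pr t
      - net.g i * passProb net sch * H.success net i Pr t * H.nonRestrict net i sch Pr t *
        H.nonEmpty Pr t := fun t ht => History.μCum_succ ht
  have he : net.g i * passProb net sch ∈ Set.Icc (0 : ℝ) 1 :=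
    ⟨mul_nonneg hg.1 hp.1, mul_le_one₀ hg.2 hp.1 hp.2⟩
  have hstatic : (∀ t, H.nonRestrict net i sch Pr t ∈ Set.Icc (0 : ℝ) 1) →
      0 ≤ H.μCum net i sch Pr t ∧ 0 ≤ H.nonEmpty Pr t * H.nonRestrict net i sch Pr t := fun hR =>
    ⟨hH.μCum_nonneg_of_nonRestrict_mem hg hR t ht, mul_nonneg hA (hR t).1⟩
  cases sch
  case baseline => exact hstatic fun _ => ⟨zero_le_one, le_rfl⟩
  case acb =>
    refine hstatic fun _ => ?_
    rw [History.nonRestrict, volume_restrict_Icc_lt net.Q_mem]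
    exact net.Q_mem
  all_goals
    have h := backoff_nonneg net.T he (fun t => H.success_mem (Pr := Pr) (net := net) (i := i) t)
      net.μNew_pos (by rw [History.μCum]) hμ (fun t ht h => hH.nonEmpty_eq ht h) t ht
    exact ⟨h.1, h.2 t ht le_rfl⟩

end History

end NBIoT

end

/-! ### Assembly of the theorem -/

theorem theorem3 {Ω : Type*} [MeasurableSpace Ω] (Pr : Measure Ω) [IsProbabilityMeasure Pr]
    (net : NBIoT.Network) (i : Fin 3)
    (hD : i = 2 → net.outer = NBIoT.OuterCase.fixedRadius → net.D₁ < net.D₂)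
    (sch : NBIoT.Scheme) (H : NBIoT.History Ω (net.K i)) (hH : H.IsModel net i sch Pr)
    (A R μCum P : ℕ → ℝ)
    (hA : A = H.nonEmpty Pr) (hR : R = H.nonRestrict net i sch Pr)
    (hμ : μCum = H.μCum net i sch Pr) (hP : P = H.success net i Pr) :
    -- the three factors and the success probability in every slot
    (∀ t, 1 ≤ t →
      (∀ n : ℕ, Pr.real {ω | H.intra t ω = n} = NBIoT.bigO net i (A t * R t) n) ∧
      (∀ m : ℕ, H.preamble net i Pr t m = NBIoT.bigTheta net i (A t * R t)) ∧
      HasSum (fun n : ℕ => NBIoT.bigO net i (A t * R t) n * NBIoT.bigTheta net i (A t * R t)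
        * (1 - NBIoT.bigTheta net i (A t * R t)) ^ n) (P t)) ∧
    -- the iteration for the non-empty probability
    (∀ t, 1 ≤ t → A t = 1 - Real.exp (-net.μNew t - μCum t)) ∧
    μCum 1 = 0 ∧
    (∀ t, 1 < t →
      (sch = .baseline →
        μCum t = net.μNew (t - 1) + μCum (t - 1) - net.g i * P (t - 1) * A (t - 1)) ∧
      (sch = .acb →
        μCum t = net.μNew (t - 1) + μCum (t - 1) - net.g i * net.Q * P (t - 1) * A (t - 1)) ∧
      (sch = .bo →
        μCum t = net.μNew (t - 1) + μCum (t - 1)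
          - net.g i * A (t - 1) * P (t - 1) * R (t - 1)) ∧
      (sch = .acbbo →
        μCum t = net.μNew (t - 1) + μCum (t - 1)
          - net.g i * net.Q * P (t - 1) * A (t - 1) * R (t - 1))) ∧
    -- the non-restrict probabilities of the four schemes
    (∀ t, 1 ≤ t →
      (sch = .baseline → R t = 1) ∧
      (sch = .acb → R t = net.Q) ∧
      (sch = .bo →
        (t ≤ net.T + 1 → R t = 1 -
          (∑ s ∈ Finset.Icc 1 (t - 1),
            (1 - net.g i * P (t - s)) * A (t - s) * R (t - s)) / A t) ∧
        (net.T < t → R t = 1 -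
          (∑ s ∈ Finset.Icc 1 net.T,
            (1 - net.g i * P (t - s)) * A (t - s) * R (t - s)) / A t)) ∧
      (sch = .acbbo →
        (t ≤ net.T + 1 → R t = 1 -
          (∑ s ∈ Finset.Icc 1 (t - 1),
            (1 - net.g i * net.Q * P (t - s)) * A (t - s) * R (t - s)) / A t) ∧
        (net.T < t → R t = 1 -
          (∑ s ∈ Finset.Icc 1 net.T,
            (1 - net.g i * net.Q * P (t - s)) * A (t - s) * R (t - s)) / A t))) := by
  have hg := net.g_mem i hD
  have hlamA : 0 ≤ net.lamA i :=
    div_nonneg (mul_nonneg hg.1 net.lamD_pos.le) (Nat.cast_nonneg _)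
  have hstep : ∀ t, 1 < t → μCum t = net.μNew (t - 1) + μCum (t - 1)
      - net.g i * NBIoT.passProb net sch * P (t - 1) * R (t - 1) * A (t - 1) := by
    intro t ht
    obtain ⟨k, rfl⟩ := Nat.exists_eq_add_of_le' ht.le
    rw [hμ, hP, hR, hA, NBIoT.History.μCum_succ (by omega), Nat.add_sub_cancel]
  have hRbase : sch = .baseline → ∀ t, R t = 1 := by
    rintro rfl t
    rw [hR, NBIoT.History.nonRestrict]
  have hRacb : sch = .acb → ∀ t, R t = net.Q := by
    rintro rfl t
    rw [hR, NBIoT.History.nonRestrict, NBIoT.volume_restrict_Icc_lt net.Q_mem]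
  -- The window length is `min (t - 1) T`. The two ranges overlap at `t = T + 1`, where both sums
  -- coincide.
  have hbo : ∀ e : ℝ, R = NBIoT.backoffProb e net.T A P → ∀ t, 1 ≤ t →
      (t ≤ net.T + 1 → R t = 1 -
        (∑ s ∈ Finset.Icc 1 (t - 1), (1 - e * P (t - s)) * A (t - s) * R (t - s)) / A t) ∧
      (net.T < t → R t = 1 -
        (∑ s ∈ Finset.Icc 1 net.T, (1 - e * P (t - s)) * A (t - s) * R (t - s)) / A t) := by
    intro e he t ht
    have h := NBIoT.backoffProb_eq e net.T A P t
    rw [← he] at h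
    refine ⟨fun h1 => ?_, fun h1 => ?_⟩
    · rwa [min_eq_left (by omega)] at h
    · rwa [min_eq_right (by omega)] at h
  refine ⟨fun t ht => ?_, fun t ht => ?_, ?_, fun t ht => ⟨?_, ?_, ?_, ?_⟩,
    fun t ht => ⟨fun h => hRbase h t, fun h => hRacb h t, ?_, ?_⟩⟩
  · have hy : 0 ≤ A t * R t * net.lamA i := by
      rw [hA, hR]
      exact mul_nonneg (hH.nonneg hg ht).2 hlamA
    have hO : ∀ n : ℕ, Pr.real {ω | H.intra t ω = n} = NBIoT.bigO net i (A t * R t) n := by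
      intro n
      rw [← NBIoT.toReal_lintegral_poissonMeasure_cell net i hy n, measureReal_def,
        hH.intra_law t ht n, hA, hR]
      rfl
    have hΘ : ∀ m : ℕ, H.preamble net i Pr t m = NBIoT.bigTheta net i (A t * R t) := by
      intro m
      have h := hH.device_law t ht m
      have h2 : H.activeDensity net i sch Pr t = A t * R t * net.lamA i := by
        rw [hA, hR]
        rfl
      rw [h2] at h
      exact h.measureReal_received hD hy
    exact ⟨hO, hΘ, hP ▸ NBIoT.History.hasSum_success (hH.measurable_intra t ht) hΘ hO⟩
  · rw [hA, hμ]
    exact hH.nonEmpty_eq ht (hH.nonneg hg ht).1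
  · rw [hμ, NBIoT.History.μCum]
  · intro h
    rw [hstep t ht, hRbase h, h, NBIoT.passProb]
    ring
  -- For ACB the factor `Q` comes from `R = Q`, with `passProb` equal to 1; for ACB&BO it comes from
  -- `passProb`.
  · intro h
    rw [hstep t ht, hRacb h, h, NBIoT.passProb]
    ring
  · intro h
    rw [hstep t ht, h, NBIoT.passProb]
    ring
  · intro h
    rw [hstep t ht, h, NBIoT.passProb]
    ring
  · rintro rfl
    have he : R = NBIoT.backoffProb (net.g i) net.T A P := by
      rw [hR, hA, hP]
      funext t
      rw [NBIoT.History.nonRestrict, NBIoT.passProb, mul_one]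
    exact hbo _ he t ht
  · rintro rfl
    exact hbo (net.g i * net.Q) (by rw [hR, hA, hP]; rfl) t ht
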